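/- Fix an integer $N>1$, a complex number $k$, and an invertible symmetric matrix $L\in M_N(\mathbb C)$. Let $\mathfrak g$ be the complexified Jacobi Lie algebra of rank $N$: the space of triples $(M,X,\kappa)$ with $M\in\mathfrak{sl}_2(\mathbb C)$, $X\in M_{N,2}(\mathbb C)$ and $\kappa\in M_N(\mathbb C)$ symmetric, with bracket $$[(M_1,X_1,\kappa_1),(M_2,X_2,\kappa_2)]=([M_1,M_2],\,X_1M_2-X_2M_1,\,X_2JX_1^T-X_1JX_2^T),\qquad J=\begin{pmatrix}0&-1\\1&0\end{pmatrix}.$$ Let $E=\epsilon_{12}$, $F=\epsilon_{21}$, $H=\epsilon_{11}-\epsilon_{22}$ in $\mathfrak{sl}_2(\mathbb C)$, $e_r=\epsilon_{r,2}$ and $f_r=\epsilon_{r,1}$ in $M_{N,2}(\mathbb C)$, $Z_{rs}=\frac12(\epsilon_{rs}+\epsilon_{sr})$ in the symmetric matrices, and set $$\tilde H=i(F-E),\quad \tilde E=\tfrac12(H+i(F+E)),\quad \tilde F=\tfrac12(H-i(F+E)),\quad \tilde e_r=\tfrac12(f_r+ie_r),\quad \tilde f_r=\tfrac12(f_r-ie_r),\quad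 \tilde Z_{rs}=\tfrac i2 Z_{rs}.$$ Let $\mathfrak k=\operatorname{Span}\{\tilde H,\tilde Z_{rs}\}$, and let $\pi_{k,L}$ be its one-dimensional representation with $\pi_{k,L}(\tilde H)=-k$ and $\pi_{k,L}(\tilde Z_{rs})=\pi L_{rs}$. Let $\mathcal I_{k,L}$ be the left ideal of $\mathfrak U(\mathfrak g)$ generated by $\{Y+\pi_{k,L}(Y):Y\in\mathfrak k\}$, and let $$\mathbb D_{k,L}=\mathfrak U(\mathfrak g)^{\mathfrak k}\big/(\mathcal I_{k,L})^{\mathfrak k}$$ be the algebra of differential operators invariant under the scalar slash action of weight $k$ and index $L$. Since $\tilde Z$ acts as the scalar matrix $z=-\pi L$, put $$\tilde E_\nu=\tilde E-\tfrac14\sum_{r,s}(z^{-1})_{rs}\tilde e_r\tilde e_s,\qquad \tilde F_\nu=\tilde F+\tfrac14\sum_{r,s}(z^{-1})_{rs}\tilde f_r\tilde f_s,$$ write $\tilde e^{I}=\tilde e_1^{I_1}\cdots\tilde e_N^{I_N}$, $\tilde f^{I}=\tilde f_1^{I_1}\cdots\tilde f_N^{I_N}$ and $|I|=I_1+\dots+I_N$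 for $I\in\mathbb N^N$, and define the following subspaces of $\mathbb D_{k,L}$, where $a,b\in\mathbb N$ and $I,K\in\mathbb N^N$: $$\mathcal L^f_{k,L}=\operatorname{Span}\{\tilde F_\nu^{a}\tilde f^{I}\tilde E_\nu^{b}\tilde e^{K}:2a+|I|=2b+|K|>0\},\qquad \mathcal L^e_{k,L}=\operatorname{Span}\{\tilde E_\nu^{b}\tilde e^{K}\tilde F_\nu^{a}\tilde f^{I}:2a+|I|=2b+|K|>0\}.$$ **Theorem.** $\mathcal L^f_{k,L}$ and $\mathcal L^e_{k,L}$ are two-sided ideals of codimension $1$ in $\mathbb D_{k,L}$, each complementary to $\mathbb C\cdot 1$. The projections $\chi^f_{k,L}$ and $\chi^e_{k,L}$ of $\mathbb D_{k,L}$ to the scalars along $\mathcal L^f_{k,L}$ and $\mathcal L^e_{k,L}$ are distinct characters (unital algebra homomorphisms to $\mathbb C$), and they are the only characters of $\mathbb D_{k,L}$. In particular, for $L=\frac1{2\pi}I_N$, the algebra $\mathbb D_k=\mathbb D_{k,I_N/2\pi}$ has exactly two characters, $\chi_k^f$ and $\chi_k^e$. -/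

import Mathlib

open scoped Matrix

noncomputable section

namespace JacobiIDO

/-- The matrix `J = (0 -1; 1 0)`. -/
def J : Matrix (Fin 2) (Fin 2) ℂ := !![0, -1; 1, 0]

lemma J_transpose : Jᵀ = -J := by
  ext i j
  fin_cases i <;> fin_cases j <;> simp [J]

/-- For traceless `M` one has `J Mᵀ = - M J`. -/
lemma J_mul_transpose (M : Matrix (Fin 2) (Fin 2) ℂ) (hM : M.trace = 0) :
    J * Mᵀ = -(M * J) := by
  have h : M 1 1 = -M 0 0 := by
    rw [Matrix.trace_fin_two] at hM
    linear_combination hM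
  ext i j
  fin_cases i <;> fin_cases j <;>
    simp [J, Matrix.mul_apply, Fin.sum_univ_two, h]

/-- The underlying vector space `sl₂(ℂ) × M_{N,2}(ℂ) × M_N^T(ℂ)` of the complexified Jacobi Lie
algebra of rank `N`: triples `(M, X, κ)` with `M` traceless and `κ` symmetric. -/
@[ext]
structure JacobiLie (N : ℕ) where
  /-- The `sl₂` component. -/
  M : Matrix (Fin 2) (Fin 2) ℂ
  /-- The `M_{N,2}` component. -/
  X : Matrix (Fin N) (Fin 2) ℂ
  /-- The symmetric (central) component. -/
  κ : Matrix (Fin N) (Fin N) ℂ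
  trace_M : M.trace = 0
  κ_transpose : κᵀ = κ

namespace JacobiLie

variable {N : ℕ}

instance : Zero (JacobiLie N) := ⟨⟨0, 0, 0, by simp, by simp⟩⟩
instance : Add (JacobiLie N) := ⟨fun x y => ⟨x.M + y.M, x.X + y.X, x.κ + y.κ,
  by rw [Matrix.trace_add, x.trace_M, y.trace_M, add_zero],
  by rw [Matrix.transpose_add, x.κ_transpose, y.κ_transpose]⟩⟩
instance : Neg (JacobiLie N) := ⟨fun x => ⟨-x.M, -x.X, -x.κ,
  by rw [Matrix.trace_neg, x.trace_M, neg_zero],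
  by rw [Matrix.transpose_neg, x.κ_transpose]⟩⟩
instance : Sub (JacobiLie N) := ⟨fun x y => ⟨x.M - y.M, x.X - y.X, x.κ - y.κ,
  by rw [Matrix.trace_sub, x.trace_M, y.trace_M, sub_zero],
  by rw [Matrix.transpose_sub, x.κ_transpose, y.κ_transpose]⟩⟩
instance : SMul ℂ (JacobiLie N) := ⟨fun c x => ⟨c • x.M, c • x.X, c • x.κ,
  by rw [Matrix.trace_smul, x.trace_M, smul_zero],
  by rw [Matrix.transpose_smul, x.κ_transpose]⟩⟩
instance : SMul ℕ (JacobiLie N) := ⟨fun c x => ⟨c • x.M, c • x.X, c • x.κ,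
  by rw [Matrix.trace_smul, x.trace_M, smul_zero],
  by rw [Matrix.transpose_smul, x.κ_transpose]⟩⟩
instance : SMul ℤ (JacobiLie N) := ⟨fun c x => ⟨c • x.M, c • x.X, c • x.κ,
  by rw [Matrix.trace_smul, x.trace_M, smul_zero],
  by rw [Matrix.transpose_smul, x.κ_transpose]⟩⟩

section simps
variable (x y : JacobiLie N) (c : ℂ)

@[simp] lemma zero_M : (0 : JacobiLie N).M = 0 := rfl
@[simp] lemma zero_X : (0 : JacobiLie N).X = 0 := rfl
@[simp] lemma zero_κ : (0 : JacobiLie N).κ = 0 := rfl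
@[simp] lemma add_M : (x + y).M = x.M + y.M := rfl
@[simp] lemma add_X : (x + y).X = x.X + y.X := rfl
@[simp] lemma add_κ : (x + y).κ = x.κ + y.κ := rfl
@[simp] lemma neg_M : (-x).M = -x.M := rfl
@[simp] lemma neg_X : (-x).X = -x.X := rfl
@[simp] lemma neg_κ : (-x).κ = -x.κ := rfl
@[simp] lemma sub_M : (x - y).M = x.M - y.M := rfl
@[simp] lemma sub_X : (x - y).X = x.X - y.X := rfl
@[simp] lemma sub_κ : (x - y).κ = x.κ - y.κ := rfl
@[simp] lemma smul_M : (c • x).M = c • x.M := rfl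
@[simp] lemma smul_X : (c • x).X = c • x.X := rfl
@[simp] lemma smul_κ : (c • x).κ = c • x.κ := rfl
end simps

/-- The three components of an element. -/
def toProd (x : JacobiLie N) : Matrix (Fin 2) (Fin 2) ℂ × Matrix (Fin N) (Fin 2) ℂ ×
    Matrix (Fin N) (Fin N) ℂ := (x.M, x.X, x.κ)

lemma toProd_injective : Function.Injective (toProd (N := N)) := by
  intro x y h
  simp only [toProd, Prod.mk.injEq] at h
  exact JacobiLie.ext h.1 h.2.1 h.2.2

instance : AddCommGroup (JacobiLie N) :=
  toProd_injective.addCommGroup toProd rfl (fun _ _ => rfl) (fun _ => rfl) (fun _ _ => rfl)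
    (fun _ _ => rfl) (fun _ _ => rfl)

instance : Module ℂ (JacobiLie N) :=
  toProd_injective.module ℂ
    { toFun := toProd, map_zero' := rfl, map_add' := fun _ _ => rfl } (fun _ _ => rfl)

/-- The bracket
`[(M₁,X₁,κ₁),(M₂,X₂,κ₂)] = ([M₁,M₂], X₁M₂ - X₂M₁, X₂JX₁ᵀ - X₁JX₂ᵀ)`. -/
instance : Bracket (JacobiLie N) (JacobiLie N) where
  bracket x y :=
    { M := x.M * y.M - y.M * x.M
      X := x.X * y.M - y.X * x.M
      κ := y.X * J * x.Xᵀ - x.X * J * y.Xᵀ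
      trace_M := by rw [Matrix.trace_sub, Matrix.trace_mul_comm, sub_self]
      κ_transpose := by
        simp only [Matrix.transpose_sub, Matrix.transpose_mul, Matrix.transpose_transpose,
          J_transpose, Matrix.mul_assoc, Matrix.neg_mul, Matrix.mul_neg]
        abel }

@[simp] lemma lie_M (x y : JacobiLie N) : ⁅x, y⁆.M = x.M * y.M - y.M * x.M := rfl
@[simp] lemma lie_X (x y : JacobiLie N) : ⁅x, y⁆.X = x.X * y.M - y.X * x.M := rfl
@[simp] lemma lie_κ (x y : JacobiLie N) : ⁅x, y⁆.κ = y.X * J * x.Xᵀ - x.X * J * y.Xᵀ := rfl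

instance : LieRing (JacobiLie N) where
  add_lie x y z := by
    ext1 <;> simp only [lie_M, lie_X, lie_κ, add_M, add_X, add_κ, Matrix.transpose_add,
      Matrix.mul_add, Matrix.add_mul] <;> abel
  lie_add x y z := by
    ext1 <;> simp only [lie_M, lie_X, lie_κ, add_M, add_X, add_κ, Matrix.transpose_add,
      Matrix.mul_add, Matrix.add_mul] <;> abel
  lie_self x := by
    ext1 <;> simp
  leibniz_lie x y z := by
    have hx := J_mul_transpose x.M x.trace_M
    have hy := J_mul_transpose y.M y.trace_M
    have hz := J_mul_transpose z.M z.trace_M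
    have key : ∀ (w : JacobiLie N) (B C : Matrix (Fin N) (Fin 2) ℂ),
        B * (J * (w.Mᵀ * Cᵀ)) = -(B * (w.M * (J * Cᵀ))) := by
      intro w B C
      rw [← Matrix.mul_assoc J, J_mul_transpose w.M w.trace_M]
      simp only [Matrix.neg_mul, Matrix.mul_neg, Matrix.mul_assoc]
    ext1
    · simp only [lie_M, add_M, Matrix.mul_sub, Matrix.sub_mul, Matrix.mul_assoc]
      abel
    · simp only [lie_M, lie_X, add_X, Matrix.mul_sub, Matrix.sub_mul, Matrix.mul_assoc]
      abel
    · simp only [lie_κ, lie_X, add_κ, Matrix.mul_sub, Matrix.sub_mul, Matrix.mul_assoc,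
        Matrix.transpose_sub, Matrix.transpose_mul, key]
      abel

instance : LieAlgebra ℂ (JacobiLie N) where
  lie_smul c x y := by
    ext1 <;> simp [smul_sub]

end JacobiLie

open JacobiLie

/-! ### The standard basis and the tilde basis -/

/-- `E = ε₁₂` in `sl₂`. -/
def E (N : ℕ) : JacobiLie N := ⟨!![0, 1; 0, 0], 0, 0, by simp [Matrix.trace_fin_two], by simp⟩
/-- `F = ε₂₁` in `sl₂`. -/
def F (N : ℕ) : JacobiLie N := ⟨!![0, 0; 1, 0], 0, 0, by simp [Matrix.trace_fin_two], by simp⟩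
/-- `H = ε₁₁ - ε₂₂` in `sl₂`. -/
def H (N : ℕ) : JacobiLie N := ⟨!![1, 0; 0, -1], 0, 0, by simp [Matrix.trace_fin_two], by simp⟩
/-- `e_r = ε_{r,2}`. -/
def e {N : ℕ} (r : Fin N) : JacobiLie N := ⟨0, Matrix.single r 1 1, 0, by simp, by simp⟩
/-- `f_r = ε_{r,1}`. -/
def f {N : ℕ} (r : Fin N) : JacobiLie N := ⟨0, Matrix.single r 0 1, 0, by simp, by simp⟩
/-- `Z_{rs} = ½ (ε_{rs} + ε_{sr})`. -/
def Z {N : ℕ} (r s : Fin N) : JacobiLie N :=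
  ⟨0, 0, (1 / 2 : ℂ) • (Matrix.single r s 1 + Matrix.single s r 1), by simp,
    by rw [Matrix.transpose_smul, Matrix.transpose_add, Matrix.transpose_single,
      Matrix.transpose_single, add_comm]⟩

/-- `H̃ = i (F - E)`. -/
def Ht (N : ℕ) : JacobiLie N := Complex.I • (F N - E N)
/-- `Ẽ = ½ (H + i (F + E))`. -/
def Et (N : ℕ) : JacobiLie N := (1 / 2 : ℂ) • (H N + Complex.I • (F N + E N))
/-- `F̃ = ½ (H - i (F + E))`. -/
def Ft (N : ℕ) : JacobiLie N := (1 / 2 : ℂ) • (H N - Complex.I • (F N + E N))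
/-- `ẽ_r = ½ (f_r + i e_r)`. -/
def et {N : ℕ} (r : Fin N) : JacobiLie N := (1 / 2 : ℂ) • (f r + Complex.I • e r)
/-- `f̃_r = ½ (f_r - i e_r)`. -/
def ft {N : ℕ} (r : Fin N) : JacobiLie N := (1 / 2 : ℂ) • (f r - Complex.I • e r)
/-- `Z̃_{rs} = ½ i Z_{rs}`. -/
def Zt {N : ℕ} (r s : Fin N) : JacobiLie N := (Complex.I / 2) • Z r s

/-! ### The stabilizer subalgebra and its characters -/

/-- The subalgebra `𝔨 = {(M, 0, κ) : M ∈ 𝔬₂(ℂ), κ ∈ M_N^T(ℂ)}`. -/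
def stab (N : ℕ) : LieSubalgebra ℂ (JacobiLie N) where
  carrier := {x | x.Mᵀ = -x.M ∧ x.X = 0}
  add_mem' := by
    rintro a b ⟨ha, ha'⟩ ⟨hb, hb'⟩
    refine ⟨?_, by simp [ha', hb']⟩
    rw [add_M, Matrix.transpose_add, ha, hb, neg_add]
  zero_mem' := by simp
  smul_mem' := by
    rintro c a ⟨ha, ha'⟩
    refine ⟨?_, by simp [ha']⟩
    rw [smul_M, Matrix.transpose_smul, ha, smul_neg]
  lie_mem' := by
    rintro a b ⟨ha, ha'⟩ ⟨hb, hb'⟩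
    refine ⟨?_, by simp [ha', hb']⟩
    simp [ha, hb]

/-- The one-dimensional representation `π_{k,L}` of `𝔨`, as a linear functional: it is the
functional with `π_{k,L}(H̃) = -k` and `π_{k,L}(Z̃_{rs}) = π L_{rs}` for symmetric `L`
(see `char_Ht` and `char_Zt`). -/
def char {N : ℕ} (k : ℂ) (L : Matrix (Fin N) (Fin N) ℂ) : stab N →ₗ[ℂ] ℂ where
  toFun Y := Complex.I * k * Y.1.M 1 0 - 2 * Real.pi * Complex.I * (Y.1.κ * L).trace
  map_add' Y Y' := by
    simp [Matrix.add_mul, Matrix.trace_add]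
    ring
  map_smul' c Y := by
    simp [Matrix.trace_smul]
    ring

lemma Ht_mem (N : ℕ) : Ht N ∈ stab N := by
  refine ⟨?_, by simp [Ht, E, F]⟩
  ext i j
  fin_cases i <;> fin_cases j <;> simp [Ht, E, F]

lemma Zt_mem {N : ℕ} (r s : Fin N) : Zt r s ∈ stab N :=
  ⟨by simp [Zt, Z], by simp [Zt, Z]⟩

lemma char_Ht {N : ℕ} (k : ℂ) (L : Matrix (Fin N) (Fin N) ℂ) :
    char k L ⟨Ht N, Ht_mem N⟩ = -k := by
  simp only [char, Ht, E, F, LinearMap.coe_mk, AddHom.coe_mk, smul_M, sub_M, smul_κ,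
    sub_κ]
  simp
  linear_combination k * Complex.I_mul_I

lemma char_Zt {N : ℕ} (k : ℂ) (L : Matrix (Fin N) (Fin N) ℂ) (hL : L.IsSymm) (r s : Fin N) :
    char k L ⟨Zt r s, Zt_mem r s⟩ = Real.pi * L r s := by
  have h : L s r = L r s := hL.apply r s
  simp only [char, Zt, Z, LinearMap.coe_mk, AddHom.coe_mk, smul_M, smul_κ]
  simp [Matrix.add_mul, Matrix.trace_add, Matrix.trace_single_mul, h]
  linear_combination (-(Real.pi : ℂ) * L r s) * Complex.I_mul_I

/-! ### The algebra of invariant differential operators -/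

/-- The universal enveloping algebra of the Jacobi Lie algebra. -/
abbrev U (N : ℕ) : Type := UniversalEnvelopingAlgebra ℂ (JacobiLie N)

attribute [local instance] LieRing.ofAssociativeRing LieAlgebra.ofAssociativeAlgebra

/-- The canonical map of the Jacobi Lie algebra into its universal enveloping algebra. -/
def ι {N : ℕ} (x : JacobiLie N) : U N := UniversalEnvelopingAlgebra.ι ℂ x

/-- The subalgebra of `𝔨`-invariants (for the adjoint action) of the enveloping algebra. -/
def invariants (N : ℕ) : Subalgebra ℂ (U N) :=
  Subalgebra.centralizer ℂ {u | ∃ Y ∈ stab N, u = ι Y}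

lemma mem_invariants {N : ℕ} {u : U N} :
    u ∈ invariants N ↔ ∀ Y ∈ stab N, ι Y * u = u * ι Y := by
  rw [invariants, Subalgebra.mem_centralizer_iff]
  constructor
  · exact fun h Y hY => h _ ⟨Y, hY, rfl⟩
  · rintro h _ ⟨Y, hY, rfl⟩
    exact h Y hY

/-- The left ideal `U(𝔤) {Y + π_{k,L}(Y) : Y ∈ 𝔨}`. -/
def leftIdeal {N : ℕ} (k : ℂ) (L : Matrix (Fin N) (Fin N) ℂ) : Ideal (U N) :=
  Ideal.span {u | ∃ Y : stab N, u = ι (Y : JacobiLie N) + algebraMap ℂ (U N) (char k L Y)}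

/-- The intersection of the left ideal with the `𝔨`-invariants, as an ideal of the latter. -/
def invIdeal {N : ℕ} (k : ℂ) (L : Matrix (Fin N) (Fin N) ℂ) : Ideal (invariants N) :=
  (leftIdeal k L).comap (invariants N).val

instance {N : ℕ} (k : ℂ) (L : Matrix (Fin N) (Fin N) ℂ) : (invIdeal k L).IsTwoSided where
  mul_mem_of_left {a} b ha := by
    have ha' : (a : U N) ∈ leftIdeal k L := ha
    change (a : U N) * (b : U N) ∈ leftIdeal k L
    refine Submodule.span_induction (p := fun x _ => x * (b : U N) ∈ leftIdeal k L)
      ?_ ?_ ?_ ?_ ha'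
    · rintro _ ⟨Y, rfl⟩
      have h1 : ι (Y : JacobiLie N) * (b : U N) = (b : U N) * ι (Y : JacobiLie N) :=
        mem_invariants.1 b.2 Y Y.2
      rw [add_mul, h1, Algebra.commutes, ← mul_add]
      exact Ideal.mul_mem_left _ _ (Ideal.subset_span ⟨Y, rfl⟩)
    · simp
    · intro x y _ _ hx hy
      rw [add_mul]
      exact Ideal.add_mem _ hx hy
    · intro c x _ hx
      rw [smul_eq_mul, mul_assoc]
      exact Ideal.mul_mem_left _ _ hx

/-- The algebra `𝔻_{k,L} = U(𝔤)^𝔨 / (I_{k,L})^𝔨` of differential operators invariant under the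
scalar slash action of weight `k` and index `L`. -/
abbrev IDO {N : ℕ} (k : ℂ) (L : Matrix (Fin N) (Fin N) ℂ) : Type :=
  invariants N ⧸ invIdeal k L

/-! ### The monomials and the two distinguished subspaces -/

/-- The scalar matrix `-π L` to which the central elements `Z̃_{rs}` are specialized. -/
def zMat {N : ℕ} (L : Matrix (Fin N) (Fin N) ℂ) : Matrix (Fin N) (Fin N) ℂ :=
  (-(Real.pi : ℂ)) • L

/-- `Ẽ_ν = Ẽ - ¼ ẽᵀ Z̃⁻¹ ẽ`, with `Z̃` specialized to `-π L`. -/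
def Enu {N : ℕ} (L : Matrix (Fin N) (Fin N) ℂ) : U N :=
  ι (Et N) - (1 / 4 : ℂ) • ∑ r, ∑ s, (zMat L)⁻¹ r s • (ι (et r) * ι (et s))

/-- `F̃_ν = F̃ + ¼ f̃ᵀ Z̃⁻¹ f̃`, with `Z̃` specialized to `-π L`. -/
def Fnu {N : ℕ} (L : Matrix (Fin N) (Fin N) ℂ) : U N :=
  ι (Ft N) + (1 / 4 : ℂ) • ∑ r, ∑ s, (zMat L)⁻¹ r s • (ι (ft r) * ι (ft s))

/-- `ẽ^I = ẽ₁^{I₁} ⋯ ẽ_N^{I_N}`. -/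
def ePow {N : ℕ} (I : Fin N → ℕ) : U N := (List.ofFn fun r => ι (et r) ^ I r).prod

/-- `f̃^I = f̃₁^{I₁} ⋯ f̃_N^{I_N}`. -/
def fPow {N : ℕ} (I : Fin N → ℕ) : U N := (List.ofFn fun r => ι (ft r) ^ I r).prod

/-- `F̃_ν^{a} f̃^{I} Ẽ_ν^{b} ẽ^{K}`. -/
def monF {N : ℕ} (L : Matrix (Fin N) (Fin N) ℂ) (a b : ℕ) (I K : Fin N → ℕ) : U N :=
  Fnu L ^ a * fPow I * Enu L ^ b * ePow K

/-- `Ẽ_ν^{b} ẽ^{K} F̃_ν^{a} f̃^{I}`. -/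
def monE {N : ℕ} (L : Matrix (Fin N) (Fin N) ℂ) (a b : ℕ) (I K : Fin N → ℕ) : U N :=
  Enu L ^ b * ePow K * Fnu L ^ a * fPow I

/-- `u` has weight `w` under the adjoint action of `𝔨` (the coefficient of `H̃` in
`Y = (M, 0, κ) ∈ 𝔨` is `-i M₂₁`). -/
def HasWeight {N : ℕ} (w : ℤ) (u : U N) : Prop :=
  ∀ Y ∈ stab N, ι Y * u = u * ι Y + ((w : ℂ) * (-Complex.I * Y.M 1 0)) • u

lemma HasWeight.mul {N : ℕ} {w w' : ℤ} {u u' : U N} (h : HasWeight w u) (h' : HasWeight w' u') :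
    HasWeight (w + w') (u * u') := by
  intro Y hY
  rw [← mul_assoc, h Y hY, add_mul, mul_assoc, h' Y hY, mul_add, smul_mul_assoc, mul_smul_comm,
    mul_assoc, add_assoc, ← add_smul]
  push_cast
  congr 2
  ring

lemma HasWeight.one {N : ℕ} : HasWeight 0 (1 : U N) := by
  intro Y _
  simp

lemma HasWeight.pow {N : ℕ} {w : ℤ} {u : U N} (h : HasWeight w u) (n : ℕ) :
    HasWeight (n * w) (u ^ n) := by
  induction n with
  | zero => simpa using HasWeight.one
  | succ n ih =>
    rw [pow_succ]
    convert ih.mul h using 1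
    push_cast
    ring

lemma HasWeight.zero {N : ℕ} {w : ℤ} : HasWeight w (0 : U N) := by
  intro Y _
  simp

lemma HasWeight.add {N : ℕ} {w : ℤ} {u u' : U N} (h : HasWeight w u) (h' : HasWeight w u') :
    HasWeight w (u + u') := by
  intro Y hY
  rw [mul_add, h Y hY, h' Y hY, add_mul, smul_add]
  abel

lemma HasWeight.smul {N : ℕ} {w : ℤ} {u : U N} (h : HasWeight w u) (c : ℂ) :
    HasWeight w (c • u) := by
  intro Y hY
  rw [mul_smul_comm, h Y hY, smul_add, smul_mul_assoc, smul_comm c]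

lemma HasWeight.sum {N : ℕ} {α : Type*} {w : ℤ} (s : Finset α) (g : α → U N)
    (h : ∀ i ∈ s, HasWeight w (g i)) : HasWeight w (∑ i ∈ s, g i) := by
  classical
  induction s using Finset.induction_on with
  | empty => simpa using HasWeight.zero
  | insert a s ha ih =>
    rw [Finset.sum_insert ha]
    exact (h a (by simp)).add (ih fun i hi => h i (by simp [hi]))

lemma hasWeight_ι {N : ℕ} {w : ℤ} {x : JacobiLie N}
    (h : ∀ Y ∈ stab N, ⁅Y, x⁆ = ((w : ℂ) * (-Complex.I * Y.M 1 0)) • x) : HasWeight w (ι x) := by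
  intro Y hY
  have h1 : ι ⁅Y, x⁆ = ι Y * ι x - ι x * ι Y := by
    simp only [ι]
    rw [LieHom.map_lie, LieRing.of_associative_ring_bracket]
  rw [h Y hY] at h1
  have h2 : ι (((w : ℂ) * (-Complex.I * Y.M 1 0)) • x) =
      ((w : ℂ) * (-Complex.I * Y.M 1 0)) • ι x := by
    simp only [ι]
    rw [map_smul]
  rw [h2] at h1
  rw [h1]
  abel

/-- The shape of an element of `𝔨`. -/
lemma stab_shape {N : ℕ} {Y : JacobiLie N} (hY : Y ∈ stab N) :
    ∃ t : ℂ, Y.M = !![0, -t; t, 0] ∧ Y.X = 0 := by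
  obtain ⟨h1, h2⟩ : Y.Mᵀ = -Y.M ∧ Y.X = 0 := hY
  refine ⟨Y.M 1 0, ?_, h2⟩
  have a := congrFun (congrFun h1 0) 0
  have b := congrFun (congrFun h1 1) 1
  have c := congrFun (congrFun h1 1) 0
  simp only [Matrix.transpose_apply, Matrix.neg_apply] at a b c
  ext i j
  fin_cases i <;> fin_cases j
  · simpa using self_eq_neg.1 a
  · simpa using c
  · rfl
  · simpa using self_eq_neg.1 b

lemma hasWeight_Et (N : ℕ) : HasWeight 2 (ι (Et N)) := by
  refine hasWeight_ι fun Y hY => ?_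
  obtain ⟨t, hM, hX⟩ := stab_shape hY
  have hI := Complex.I_mul_I
  ext i j
  · fin_cases i <;> fin_cases j <;> simp [Et, E, F, H, hM] <;>
      first | ring1 | linear_combination (t * hI)
  · simp [Et, E, F, H, hX]
  · simp [Et, E, F, H, hX]

lemma hasWeight_Ft (N : ℕ) : HasWeight (-2) (ι (Ft N)) := by
  refine hasWeight_ι fun Y hY => ?_
  obtain ⟨t, hM, hX⟩ := stab_shape hY
  have hI := Complex.I_mul_I
  ext i j
  · fin_cases i <;> fin_cases j <;> simp [Ft, E, F, H, hM] <;>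
      first | ring1 | linear_combination (t * hI)
  · simp [Ft, E, F, H, hX]
  · simp [Ft, E, F, H, hX]

lemma hasWeight_et {N : ℕ} (r : Fin N) : HasWeight 1 (ι (et r)) := by
  refine hasWeight_ι fun Y hY => ?_
  obtain ⟨t, hM, hX⟩ := stab_shape hY
  have hI := Complex.I_mul_I
  ext i j
  · simp [et, e, f]
  · by_cases hi : r = i <;> fin_cases j <;>
      simp [et, e, f, Matrix.mul_apply, Matrix.single_apply, hi, hM, hX] <;>
      first | ring1 | linear_combination (t / 2 * hI)
  · simp [et, e, f, hX]

lemma hasWeight_ft {N : ℕ} (r : Fin N) : HasWeight (-1) (ι (ft r)) := by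
  refine hasWeight_ι fun Y hY => ?_
  obtain ⟨t, hM, hX⟩ := stab_shape hY
  have hI := Complex.I_mul_I
  ext i j
  · simp [ft, e, f]
  · by_cases hi : r = i <;> fin_cases j <;>
      simp [ft, e, f, Matrix.mul_apply, Matrix.single_apply, hi, hM, hX] <;>
      first | ring1 | linear_combination (t / 2 * hI)
  · simp [ft, e, f, hX]

lemma hasWeight_Enu {N : ℕ} (L : Matrix (Fin N) (Fin N) ℂ) : HasWeight 2 (Enu L) := by
  have h : HasWeight 2 (∑ r, ∑ s, (zMat L)⁻¹ r s • (ι (et r) * ι (et s))) :=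
    HasWeight.sum _ _ fun r _ => HasWeight.sum _ _ fun s _ =>
      ((hasWeight_et r).mul (hasWeight_et s)).smul _
  rw [Enu, sub_eq_add_neg, ← neg_smul]
  exact (hasWeight_Et N).add (h.smul _)

lemma hasWeight_Fnu {N : ℕ} (L : Matrix (Fin N) (Fin N) ℂ) : HasWeight (-2) (Fnu L) := by
  have h : HasWeight (-2) (∑ r, ∑ s, (zMat L)⁻¹ r s • (ι (ft r) * ι (ft s))) :=
    HasWeight.sum _ _ fun r _ => HasWeight.sum _ _ fun s _ =>
      ((hasWeight_ft r).mul (hasWeight_ft s)).smul _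
  exact (hasWeight_Ft N).add (h.smul _)

lemma hasWeight_ofFn {N n : ℕ} {w : ℤ} (g : Fin n → U N) (hg : ∀ r, HasWeight w (g r))
    (I : Fin n → ℕ) :
    HasWeight ((∑ r, I r : ℕ) * w) (List.ofFn fun r => g r ^ I r).prod := by
  induction n with
  | zero => simpa using HasWeight.one
  | succ n ih =>
    rw [List.ofFn_succ, List.prod_cons, Fin.sum_univ_succ]
    convert ((hg 0).pow (I 0)).mul (ih (fun r => g r.succ) (fun r => hg _) fun r => I r.succ)
      using 1
    push_cast
    ring

lemma HasWeight.mem_invariants {N : ℕ} {u : U N} (h : HasWeight 0 u) : u ∈ invariants N := by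
  rw [JacobiIDO.mem_invariants]
  intro Y hY
  simpa using h Y hY

lemma monF_mem {N : ℕ} (L : Matrix (Fin N) (Fin N) ℂ) (a b : ℕ) (I K : Fin N → ℕ)
    (h : 2 * a + ∑ r, I r = 2 * b + ∑ r, K r) : monF L a b I K ∈ invariants N := by
  refine HasWeight.mem_invariants ?_
  convert ((((hasWeight_Fnu L).pow a).mul (hasWeight_ofFn _ hasWeight_ft I)).mul
    ((hasWeight_Enu L).pow b)).mul (hasWeight_ofFn _ hasWeight_et K) using 1
  swap
  · rfl
  have h' : (2 * a + (∑ r, I r : ℕ) : ℤ) = 2 * b + (∑ r, K r : ℕ) := by exact_mod_cast h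
  linarith

lemma monE_mem {N : ℕ} (L : Matrix (Fin N) (Fin N) ℂ) (a b : ℕ) (I K : Fin N → ℕ)
    (h : 2 * a + ∑ r, I r = 2 * b + ∑ r, K r) : monE L a b I K ∈ invariants N := by
  refine HasWeight.mem_invariants ?_
  convert ((((hasWeight_Enu L).pow b).mul (hasWeight_ofFn _ hasWeight_et K)).mul
    ((hasWeight_Fnu L).pow a)).mul (hasWeight_ofFn _ hasWeight_ft I) using 1
  swap
  · rfl
  have h' : (2 * a + (∑ r, I r : ℕ) : ℤ) = 2 * b + (∑ r, K r : ℕ) := by exact_mod_cast h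
  linarith

/-- The projection of the `𝔨`-invariants of `U(𝔤)` onto `𝔻_{k,L}`. -/
def proj {N : ℕ} (k : ℂ) (L : Matrix (Fin N) (Fin N) ℂ) : invariants N →ₐ[ℂ] IDO k L :=
  Ideal.Quotient.mkₐ ℂ (invIdeal k L)

/-- The span in `𝔻_{k,L}` of the `F̃_ν^{a} f̃^{I} Ẽ_ν^{b} ẽ^{K}` with
`2a + |I| = 2b + |K| > 0`. -/
def Lf {N : ℕ} (k : ℂ) (L : Matrix (Fin N) (Fin N) ℂ) : Submodule ℂ (IDO k L) :=
  Submodule.span ℂ {d | ∃ (a b : ℕ) (I K : Fin N → ℕ)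
    (h : 2 * a + ∑ r, I r = 2 * b + ∑ r, K r), 0 < 2 * a + ∑ r, I r ∧
      d = proj k L ⟨monF L a b I K, monF_mem L a b I K h⟩}

/-- The span in `𝔻_{k,L}` of the `Ẽ_ν^{b} ẽ^{K} F̃_ν^{a} f̃^{I}` with
`2a + |I| = 2b + |K| > 0`. -/
def Le {N : ℕ} (k : ℂ) (L : Matrix (Fin N) (Fin N) ℂ) : Submodule ℂ (IDO k L) :=
  Submodule.span ℂ {d | ∃ (a b : ℕ) (I K : Fin N → ℕ)
    (h : 2 * a + ∑ r, I r = 2 * b + ∑ r, K r), 0 < 2 * a + ∑ r, I r ∧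
      d = proj k L ⟨monE L a b I K, monE_mem L a b I K h⟩}

/-- `S` is a two-sided ideal of codimension one in the algebra `A`. -/
def IsCodimOneTwoSidedIdeal {A : Type*} [Ring A] [Algebra ℂ A] (S : Submodule ℂ A) : Prop :=
  (∀ a, ∀ s ∈ S, a * s ∈ S ∧ s * a ∈ S) ∧ Module.finrank ℂ (A ⧸ S) = 1

/-- `χ` is the projection to the scalars `ℂ · 1` along the subspace `S`: the algebra is the direct
sum of `ℂ · 1` and `S`, and `χ (c · 1 + s) = c`. -/
def IsProjectionAlong {A : Type*} [Ring A] [Algebra ℂ A] (χ : A →ₐ[ℂ] ℂ) (S : Submodule ℂ A) :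
    Prop :=
  IsCompl (Submodule.span ℂ {(1 : A)}) S ∧ ∀ (c : ℂ), ∀ s ∈ S, χ (algebraMap ℂ A c + s) = c

end JacobiIDO

end

open scoped Matrix

noncomputable section

namespace JacobiIDO

open JacobiLie

attribute [local instance] LieRing.ofAssociativeRing LieAlgebra.ofAssociativeAlgebra

/-! ### Products of commuting families -/

/-! On `𝔘(𝔤)/𝓘` each `Z̃_{rs}` acts by the scalar `z_{rs} = -π L_{rs}`. Since `z` is invertible,
completing the square gives elements `Ẽ_ν`, `F̃_ν` that commute with every `ẽ_r` and `f̃_r`, and the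
latter satisfy the Weyl relations `[ẽ_r, f̃_s] = -2 z_{rs}` (`JacobiRel.split`). All relations
survive the exchange of raising and lowering elements together with `z ↦ -z` and `H̃ ↦ -H̃`, so only
one of the two cases has to be argued.

Spanning: straightening words in the induced module and keeping those of weight zero gives `𝔻 = ℂ·1
+ 𝓛^f` and `𝔻 = ℂ·1 + 𝓛^e` (`span_one_sup_Lf`, `span_one_sup_Le`).

Existence: an oscillator module tensored with a Verma module contains a vector killed by `Ẽ_ν` and
all `ẽ_r`, on which `𝔨` acts by `-π_{k,L}`. The left ideal kills this vector and so does every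
monomial of `𝓛^f`, so `𝔻` acts on it by scalars; this is a character vanishing on `𝓛^f`
(`exists_char_of_vector`, `exists_char_Lf`). Its kernel is then exactly `𝓛^f`, which gives the ideal
property, the codimension and the direct sum with no need for linear independence of monomials.

Uniqueness: for a character `Φ`, commutativity of its values forces `Φ(f̃_s ẽ_r) = c z_{rs}`.
Comparing two products with the same quartic term forces `c(c-2)` times a 2×2 minor of `z` to
vanish. As `N > 1`, some minor is nonzero, so `c = 0` or `c = 2` (`map_fe_dichotomy`). In the first
case `Φ` kills every monomial of `𝓛^f` (`map_monomial_eq_zero`), in the second every monomial of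
`𝓛^e`. Both cannot happen, because `[ẽ_r, f̃_s]` is a nonzero scalar for some `r, s`
(`not_vanishes_both`). -/

lemma exists_list_of_ofFn_pow {A : Type*} [Monoid A] {n : ℕ} (x : Fin n → A) (I : Fin n → ℕ) :
    ∃ l : List (Fin n), l.length = ∑ r, I r ∧
      (List.ofFn fun r => x r ^ I r).prod = (l.map x).prod := by
  refine ⟨(List.ofFn fun r => List.replicate (I r) r).flatten, ?_, ?_⟩
  · rw [List.length_flatten, List.map_ofFn, List.sum_ofFn]
    simp
  · rw [List.map_flatten, List.prod_flatten, List.map_ofFn, List.map_ofFn]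
    simp [Function.comp_def]

lemma mul_ofFn_pow {A : Type*} [Monoid A] {n : ℕ} (x : Fin n → A)
    (hx : ∀ r s, Commute (x r) (x s)) (I : Fin n → ℕ) (r : Fin n) :
    x r * (List.ofFn fun s => x s ^ I s).prod =
      (List.ofFn fun s => x s ^ (I s + if s = r then 1 else 0)).prod := by
  induction n with
  | zero => exact r.elim0
  | succ n ih =>
    rw [List.ofFn_succ, List.prod_cons, List.ofFn_succ, List.prod_cons]
    refine Fin.cases ?_ (fun i => ?_) r
    · simp [← mul_assoc, pow_succ', Fin.succ_ne_zero]
    · rw [← mul_assoc, ((hx i.succ 0).pow_right (I 0)).eq, mul_assoc]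
      have h := ih (fun s => x s.succ) (fun r s => hx _ _) (fun s => I s.succ) i
      rw [h]
      congr 1
      simp

/-- Words in commuting letters can be sorted. With `exists_list_of_ofFn_pow` this translates between
exponent vectors and lists; on lists the inductions can treat one letter at a time. -/
lemma exists_ofFn_pow_of_list {A : Type*} [Monoid A] {n : ℕ} (x : Fin n → A)
    (hx : ∀ r s, Commute (x r) (x s)) (l : List (Fin n)) :
    ∃ I : Fin n → ℕ, ∑ r, I r = l.length ∧
      (l.map x).prod = (List.ofFn fun r => x r ^ I r).prod := by
  induction l with
  | nil => exact ⟨0, by simp, by simp⟩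
  | cons r l ih =>
    obtain ⟨I, hI, h⟩ := ih
    refine ⟨fun s => I s + if s = r then 1 else 0, by simp [Finset.sum_add_distrib, hI], ?_⟩
    rw [List.map_cons, List.prod_cons, h, mul_ofFn_pow x hx]

lemma commute_list_prod {A : Type*} [Monoid A] {n : Type*} {x : n → A} {a : A}
    (h : ∀ r, Commute a (x r)) (l : List n) : Commute a (l.map x).prod := by
  refine Commute.list_prod_right _ _ fun b hb => ?_
  obtain ⟨r, -, rfl⟩ := List.mem_map.1 hb
  exact h r

/-! ### The decoupled relations -/

/-- The relations of the Weyl algebra: `[e_r, f_s] = -2 z_{rs}`. -/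
structure WeylRel {A : Type*} [Ring A] [Algebra ℂ A] {N : ℕ} (z : Matrix (Fin N) (Fin N) ℂ)
    (e f : Fin N → A) : Prop where
  ee : ∀ r s, Commute (e r) (e s)
  ff : ∀ r s, Commute (f r) (f s)
  ef : ∀ r s, e r * f s = f s * e r - (2 * z r s) • 1

/-- The relations between `E = Ẽ_ν`, `F = F̃_ν`, `h = H̃`, `e_r = ẽ_r` and `f_r = f̃_r` in an algebra
in which the central elements `Z̃_{rs}` are the scalars `z_{rs}`. -/
structure SplitRel {A : Type*} [Ring A] [Algebra ℂ A] {N : ℕ} (z : Matrix (Fin N) (Fin N) ℂ)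
    (E F h : A) (e f : Fin N → A) : Prop extends WeylRel z e f where
  Ee : ∀ r, Commute E (e r)
  Ef : ∀ r, Commute E (f r)
  Fe : ∀ r, Commute F (e r)
  Ff : ∀ r, Commute F (f r)
  EF : E * F = F * E + h - (1 / 4 : ℂ) • ∑ r, ∑ s, z⁻¹ r s • (e r * f s + f r * e s)
  he : ∀ r, h * e r = e r * h + e r
  hf : ∀ r, h * f r = f r * h - f r
  hE : h * E = E * h + (2 : ℂ) • E
  hF : h * F = F * h - (2 : ℂ) • F

/-- The symmetry between raising and lowering elements replaces `z` by `-z`, hence `z⁻¹` by `-z⁻¹`.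
The singular case relies on the inverse being `0` there. -/
lemma inv_neg_matrix {n : Type*} [Fintype n] [DecidableEq n] (z : Matrix n n ℂ) :
    (-z)⁻¹ = -z⁻¹ := by
  by_cases h : IsUnit z.det
  · refine Matrix.inv_eq_left_inv ?_
    rw [neg_mul_neg, Matrix.nonsing_inv_mul _ h]
  · have h' : ¬ IsUnit (-z).det := by
      rw [Matrix.det_neg]
      simpa [isUnit_iff_ne_zero] using h
    rw [Matrix.nonsing_inv_apply_not_isUnit _ h, Matrix.nonsing_inv_apply_not_isUnit _ h', neg_zero]

section Split

variable {A : Type*} [Ring A] [Algebra ℂ A] {N : ℕ} {z : Matrix (Fin N) (Fin N) ℂ}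
  {E F h : A} {e f : Fin N → A}

lemma WeylRel.swap (R : WeylRel z e f) (hz : z.IsSymm) : WeylRel (-z) f e where
  ee := R.ff
  ff := R.ee
  ef r s := by
    rw [R.ef, Matrix.neg_apply, hz.apply r s, mul_neg, neg_smul]
    abel

/-- The relations are symmetric in the raising and the lowering elements. -/
lemma SplitRel.swap (R : SplitRel z E F h e f) (hz : z.IsSymm) : SplitRel (-z) F E (-h) f e where
  toWeylRel := R.toWeylRel.swap hz
  Ee := R.Ff
  Ef := R.Fe
  Fe := R.Ef
  Ff := R.Ee
  EF := by
    rw [R.EF, inv_neg_matrix]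
    simp only [Matrix.neg_apply, neg_smul, Finset.sum_neg_distrib, smul_neg, add_comm (f _ * e _)]
    abel
  he r := by
    rw [neg_mul, R.hf, mul_neg]
    abel
  hf r := by
    rw [neg_mul, R.he, mul_neg]
    abel
  hE := by
    rw [neg_mul, R.hF, mul_neg]
    abel
  hF := by
    rw [neg_mul, R.hE, mul_neg]
    abel

/-- Moving a power of `f_p` to the left of `e_r`. -/
lemma SplitRel.e_mul_f_pow (R : SplitRel z E F h e f) (r p : Fin N) (n : ℕ) :
    e r * f p ^ n = f p ^ n * e r - (2 * n * z r p) • f p ^ (n - 1) := by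
  induction n with
  | zero => simp
  | succ n ih =>
    -- For `n = 0` the truncated exponent `n - 1` is harmless because the coefficient vanishes.
    have h1 : (2 * (n : ℂ) * z r p) • (f p ^ (n - 1) * f p) = (2 * (n : ℂ) * z r p) • f p ^ n := by
      rcases n with _ | n
      · simp
      · rw [Nat.add_sub_cancel, ← pow_succ]
    rw [pow_succ, ← mul_assoc, ih, sub_mul, mul_assoc, R.ef, mul_sub, smul_mul_assoc, h1,
      Nat.add_sub_cancel, mul_smul_comm, mul_one, ← mul_assoc, sub_sub, ← add_smul]
    push_cast
    ring_nf

/-- Moving `f_p` to the left of a power of `e_r`. -/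
lemma SplitRel.e_pow_mul_f (R : SplitRel z E F h e f) (r p : Fin N) (n : ℕ) :
    e r ^ n * f p = f p * e r ^ n - (2 * n * z r p) • e r ^ (n - 1) := by
  induction n with
  | zero => simp
  | succ n ih =>
    have h1 : (2 * (n : ℂ) * z r p) • (e r * e r ^ (n - 1)) = (2 * (n : ℂ) * z r p) • e r ^ n := by
      rcases n with _ | n
      · simp
      · rw [Nat.add_sub_cancel, ← pow_succ']
    rw [pow_succ', mul_assoc, ih, mul_sub, ← mul_assoc, R.ef, sub_mul, mul_smul_comm, h1,
      Nat.add_sub_cancel, smul_mul_assoc, one_mul, mul_assoc, sub_sub, ← add_smul]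
    push_cast
    ring_nf

/-- A linear functional that is multiplicative on the weight zero part of a graded algebra. -/
structure GradedChar (G : ℤ → Submodule ℂ A) (Φ : A →ₗ[ℂ] ℂ) : Prop where
  one_mem : 1 ∈ G 0
  mul_mem : ∀ i j x y, x ∈ G i → y ∈ G j → x * y ∈ G (i + j)
  map_one : Φ 1 = 1
  map_mul : ∀ x y, x ∈ G 0 → y ∈ G 0 → Φ (x * y) = Φ x * Φ y

/-- The generators are homogeneous. -/
structure IsHomog (G : ℤ → Submodule ℂ A) (E F : A) (e f : Fin N → A) : Prop where
  e : ∀ r, e r ∈ G 1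
  f : ∀ r, f r ∈ G (-1)
  E : E ∈ G 2
  F : F ∈ G (-2)

variable {G : ℤ → Submodule ℂ A} {Φ : A →ₗ[ℂ] ℂ}

lemma GradedChar.swap (C : GradedChar G Φ) : GradedChar (fun w => G (-w)) Φ where
  one_mem := by simpa using C.one_mem
  mul_mem i j x y hx hy := by
    have := C.mul_mem _ _ x y hx hy
    rwa [← neg_add] at this
  map_one := C.map_one
  map_mul x y hx hy := C.map_mul x y (by simpa using hx) (by simpa using hy)

lemma IsHomog.swap (C : IsHomog G E F e f) : IsHomog (fun w => G (-w)) F E f e where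
  e := C.f
  f r := by simpa using C.e r
  E := C.F
  F := by simpa using C.E

lemma GradedChar.mul_mem' (C : GradedChar G Φ) {i j k : ℤ} {x y : A} (hx : x ∈ G i) (hy : y ∈ G j)
    (hk : i + j = k) : x * y ∈ G k := hk ▸ C.mul_mem _ _ _ _ hx hy

lemma GradedChar.pow_mem (C : GradedChar G Φ) {i : ℤ} {x : A} (hx : x ∈ G i) (n : ℕ) :
    x ^ n ∈ G (n * i) := by
  induction n with
  | zero => simpa using C.one_mem
  | succ n ih =>
    rw [pow_succ]
    exact C.mul_mem' ih hx (by push_cast; ring)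

lemma GradedChar.list_prod_mem (C : GradedChar G Φ) {i : ℤ} {x : Fin N → A} (hx : ∀ r, x r ∈ G i)
    (l : List (Fin N)) : (l.map x).prod ∈ G (l.length * i) := by
  induction l with
  | nil => simpa using C.one_mem
  | cons r l ih =>
    rw [List.map_cons, List.prod_cons, List.length_cons]
    exact C.mul_mem' (hx r) ih (by push_cast; ring)

/-! ### Values of a character on the products `f_s e_r` -/

lemma fe_mem (C : GradedChar G Φ) (D : IsHomog G E F e f) (s r : Fin N) : f s * e r ∈ G 0 :=
  C.mul_mem' (D.f s) (D.e r) (by norm_num)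

lemma fe_mul_fe (R : SplitRel z E F h e f) (s r q p : Fin N) :
    (f s * e r) * (f q * e p) = f s * f q * (e r * e p) - (2 * z r q) • (f s * e p) := by
  rw [mul_assoc, ← mul_assoc (e r), R.ef]
  simp only [sub_mul, mul_sub, smul_mul_assoc, mul_smul_comm, one_mul, mul_assoc]

/-- The two orders of multiplying `f_s e_r` and `f_q e_p` have the same value under `Φ` and the same
quartic term, so the quadratic corrections agree. -/
lemma map_fe_comm (R : SplitRel z E F h e f) (C : GradedChar G Φ) (D : IsHomog G E F e f)
    (s r q p : Fin N) : z r q * Φ (f s * e p) = z p s * Φ (f q * e r) := by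
  have h1 := congrArg Φ (fe_mul_fe R s r q p)
  have h2 := congrArg Φ (fe_mul_fe R q p s r)
  rw [(R.ff q s).eq, (R.ee p r).eq] at h2
  rw [C.map_mul _ _ (fe_mem C D _ _) (fe_mem C D _ _), map_sub, map_smul, smul_eq_mul] at h1 h2
  linear_combination (h1 - h2) / 2

/-- Exchanging `r` and `p` leaves the quartic term `f_s f_q e_r e_p` unchanged; eliminating it
between the two expansions leaves a relation among quadratic values only. -/
lemma map_fe_exchange (R : SplitRel z E F h e f) (C : GradedChar G Φ) (D : IsHomog G E F e f)
    (s r q p : Fin N) :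
    Φ (f s * e r) * Φ (f q * e p) + 2 * z r q * Φ (f s * e p) =
      Φ (f s * e p) * Φ (f q * e r) + 2 * z p q * Φ (f s * e r) := by
  have h1 := congrArg Φ (fe_mul_fe R s r q p)
  have h2 := congrArg Φ (fe_mul_fe R s p q r)
  rw [(R.ee p r).eq] at h2
  rw [C.map_mul _ _ (fe_mem C D _ _) (fe_mem C D _ _), map_sub, map_smul, smul_eq_mul] at h1 h2
  linear_combination h1 - h2

/-- If all 2×2 minors vanish, contracting with `z⁻¹` in the index `r` gives `δ_{st} z_{qp} = z_{sp}
δ_{qt}`. Taking `t = s ≠ q`, which is possible since `N > 1`, gives `z = 0`. -/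
lemma exists_minor_ne_zero (hN : 1 < N) (hz : IsUnit z.det) :
    ∃ s r q p, z s r * z q p - z s p * z q r ≠ 0 := by
  by_contra! hcon
  have hw := Matrix.mul_nonsing_inv z hz
  have key : ∀ s t q p, (1 : Matrix (Fin N) (Fin N) ℂ) s t * z q p =
      z s p * (1 : Matrix (Fin N) (Fin N) ℂ) q t := by
    intro s t q p
    rw [← hw, Matrix.mul_apply, Matrix.mul_apply, Finset.sum_mul, Finset.mul_sum]
    refine Finset.sum_congr rfl fun r _ => ?_
    linear_combination (z⁻¹ r t) * hcon s r q p
  have hz0 : z = 0 := by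
    ext q p
    obtain ⟨s, hs⟩ : ∃ s : Fin N, s ≠ q := by
      have : Nontrivial (Fin N) := Fin.nontrivial_iff_two_le.2 hN
      exact exists_ne q
    have := key s s q p
    rw [Matrix.one_apply_eq, Matrix.one_apply_ne hs.symm] at this
    simpa using this
  have : Nonempty (Fin N) := ⟨⟨0, by omega⟩⟩
  rw [hz0, Matrix.det_zero] at hz
  exact not_isUnit_zero hz

/-- A character of the weight zero part kills all `f_s e_r`, or all `e_r f_s`. -/
lemma map_fe_dichotomy (R : SplitRel z E F h e f) (C : GradedChar G Φ) (D : IsHomog G E F e f)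
    (hN : 1 < N) (hsymm : z.IsSymm) (hz : IsUnit z.det) :
    (∀ s r, Φ (f s * e r) = 0) ∨ ∀ r s, Φ (e r * f s) = 0 := by
  obtain ⟨s, r, q, p, hm⟩ := exists_minor_ne_zero hN hz
  obtain ⟨u, v, huv⟩ : ∃ u v, z u v ≠ 0 := by
    by_contra! h0
    exact hm (by simp [h0])
  -- By `map_fe_comm` the matrix of values is proportional to `z`; one nonzero entry fixes the
  -- factor `c`.
  set c := Φ (f v * e u) / z u v with hc
  have hX : ∀ s p, Φ (f s * e p) = c * z p s := by
    intro s p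
    rw [hc, div_mul_eq_mul_div, eq_div_iff huv]
    linear_combination map_fe_comm R C D s u v p
  have h1 := map_fe_exchange R C D s r q p
  simp only [hX] at h1
  have h2 : c * (c - 2) * (z s r * z q p - z s p * z q r) = 0 := by
    rw [← hsymm.apply s r, ← hsymm.apply q p, ← hsymm.apply s p, ← hsymm.apply q r]
    linear_combination h1
  rcases mul_eq_zero.1 ((mul_eq_zero.1 h2).resolve_right hm) with h3 | h3
  · left
    intro s r
    rw [hX, h3, zero_mul]
  · right
    intro r s
    rw [R.ef, map_sub, map_smul, hX, C.map_one, smul_eq_mul]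
    linear_combination z r s * h3

/-- Splitting off `f_p e_r`, which `Φ` kills, multiplies the value by `-2(n+1) z_{rp}` at each step,
so the value is `n! (-2 z_{rp})^n`. -/
lemma map_e_pow_f_pow_ne_zero (R : SplitRel z E F h e f) (C : GradedChar G Φ)
    (D : IsHomog G E F e f) (h0 : ∀ s r, Φ (f s * e r) = 0) {r p : Fin N} (hrp : z r p ≠ 0)
    (n : ℕ) : Φ (e r ^ n * f p ^ n) ≠ 0 := by
  induction n with
  | zero => simp [C.map_one]
  | succ n ih =>
    have hG : e r ^ n * f p ^ n ∈ G 0 :=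
      C.mul_mem' (C.pow_mem (D.e r) n) (C.pow_mem (D.f p) n) (by ring)
    have h1 : e r ^ (n + 1) * f p ^ (n + 1) = e r ^ n * f p ^ n * (f p * e r) -
        (2 * (n + 1 : ℕ) * z r p) • (e r ^ n * f p ^ n) := by
      rw [pow_succ (e r), mul_assoc, R.e_mul_f_pow, mul_sub, mul_smul_comm, Nat.add_sub_cancel,
        pow_succ (f p)]
      simp only [mul_assoc]
    rw [h1, map_sub, C.map_mul _ _ hG (fe_mem C D _ _), h0, mul_zero, zero_sub, map_smul, neg_ne_zero,
      smul_eq_mul]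
    refine mul_ne_zero (mul_ne_zero (mul_ne_zero two_ne_zero ?_) hrp) ih
    exact_mod_cast n.succ_ne_zero

/-- This element is an eigenvector, with nonzero eigenvalue, for the commutator with `f_p e_r`: `F`
commutes with `f_p e_r`, and `e_r^{2a}` has degree `2a > 0` in the oscillator variables. A character
kills commutators of weight zero elements. -/
lemma map_F_pow_e_pow (R : SplitRel z E F h e f) (C : GradedChar G Φ)
    (D : IsHomog G E F e f) (h0 : ∀ s r, Φ (f s * e r) = 0) {r p : Fin N} (hrp : z r p ≠ 0)
    {a : ℕ} (ha : 0 < a) : Φ (F ^ a * e r ^ (2 * a)) = 0 := by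
  have hG : F ^ a * e r ^ (2 * a) ∈ G 0 :=
    C.mul_mem' (C.pow_mem D.F a) (C.pow_mem (D.e r) (2 * a)) (by push_cast; ring)
  obtain ⟨b, hb⟩ : ∃ b, 2 * a = b + 1 := ⟨2 * a - 1, by omega⟩
  have h1 : (F ^ a * e r ^ (2 * a)) * (f p * e r) = (f p * e r) * (F ^ a * e r ^ (2 * a)) -
      (2 * (2 * a : ℕ) * z r p) • (F ^ a * e r ^ (2 * a)) := by
    have c1 : f p * e r * F ^ a = F ^ a * (f p * e r) :=
      (((R.Ff p).pow_left a).mul_right ((R.Fe r).pow_left a)).eq.symm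
    rw [← mul_assoc (f p * e r), c1, mul_assoc, ← mul_assoc (e r ^ _), R.e_pow_mul_f, sub_mul,
      mul_sub, smul_mul_assoc, mul_smul_comm, hb, Nat.add_sub_cancel, ← pow_succ]
    simp only [mul_assoc, ← pow_succ, ← pow_succ']
  have h2 := congrArg Φ h1
  rw [map_sub, C.map_mul _ _ hG (fe_mem C D _ _), C.map_mul _ _ (fe_mem C D _ _) hG, h0, map_smul,
    smul_eq_mul, mul_zero, zero_mul, zero_sub, eq_comm, neg_eq_zero] at h2
  refine (mul_eq_zero.1 h2).resolve_left (mul_ne_zero (mul_ne_zero two_ne_zero ?_) hrp)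
  exact_mod_cast (by omega : 2 * a ≠ 0)

/-- One letter `f_s` is moved through `e_r^m` to sit next to the last `e_r`, where the factor `f_s
e_r` is killed; the correction is a shorter element of the same kind. -/
lemma map_F_pow_f_list_e_pow (R : SplitRel z E F h e f) (C : GradedChar G Φ)
    (D : IsHomog G E F e f) (h0 : ∀ s r, Φ (f s * e r) = 0) {r p : Fin N} (hrp : z r p ≠ 0)
    (a n : ℕ) (l : List (Fin N)) (hn : 2 * a + l.length = n) (hpos : 0 < n) :
    Φ (F ^ a * (l.map f).prod * e r ^ n) = 0 := by
  induction l generalizing n with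
  | nil =>
    simp only [List.length_nil, add_zero] at hn
    subst hn
    simpa using map_F_pow_e_pow R C D h0 hrp (by omega : 0 < a)
  | cons s l ih =>
    obtain ⟨m, rfl⟩ : ∃ m, n = m + 1 := ⟨n - 1, by omega⟩
    rw [List.length_cons] at hn
    have hG : F ^ a * (l.map f).prod * e r ^ m ∈ G 0 :=
      C.mul_mem' (C.mul_mem' (C.pow_mem D.F a) (C.list_prod_mem D.f l) rfl) (C.pow_mem (D.e r) m)
        (by push_cast [← (by omega : 2 * a + l.length = m)]; ring)
    have hmul : (2 * (m : ℂ) * z r s) • (e r ^ (m - 1) * e r) = (2 * (m : ℂ) * z r s) • e r ^ m := by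
      rcases m with _ | m
      · simp
      · rw [Nat.add_sub_cancel, ← pow_succ]
    have h1 : F ^ a * ((s :: l).map f).prod * e r ^ (m + 1) =
        F ^ a * (l.map f).prod * e r ^ m * (f s * e r) +
          (2 * m * z r s) • (F ^ a * (l.map f).prod * e r ^ m) := by
      have h2 : f s * e r ^ (m + 1) = e r ^ m * (f s * e r) + (2 * m * z r s) • e r ^ m := by
        rw [← hmul, ← mul_assoc, R.e_pow_mul_f, sub_mul, smul_mul_assoc, sub_add_cancel, mul_assoc,
          ← pow_succ]
      rw [List.map_cons, List.prod_cons, (commute_list_prod (R.ff s) l).eq, ← mul_assoc, mul_assoc,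
        h2, mul_add, mul_smul_comm, mul_assoc, mul_assoc, mul_assoc, mul_assoc, mul_assoc]
    rw [h1, map_add, C.map_mul _ _ hG (fe_mem C D _ _), h0, mul_zero, zero_add, map_smul, smul_eq_mul]
    -- At `m = 0` the remaining element is `1`, which `Φ` does not kill, but its coefficient `2 m
    -- z_{rs}` is zero.
    rcases Nat.eq_zero_or_pos m with rfl | hm
    · simp
    · rw [ih m (by omega) hm, mul_zero]

/-- A character of the weight zero part that kills all `f_s e_r` kills all normally ordered
monomials. -/
lemma map_monomial_eq_zero (R : SplitRel z E F h e f) (C : GradedChar G Φ)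
    (D : IsHomog G E F e f) (h0 : ∀ s r, Φ (f s * e r) = 0) {r p : Fin N} (hrp : z r p ≠ 0)
    (a b : ℕ) (l l' : List (Fin N)) (hn : 2 * a + l.length = 2 * b + l'.length)
    (hpos : 0 < 2 * a + l.length) :
    Φ (F ^ a * (l.map f).prod * E ^ b * (l'.map e).prod) = 0 := by
  obtain ⟨n, hn'⟩ : ∃ n, 2 * a + l.length = n := ⟨_, rfl⟩
  have hx : F ^ a * (l.map f).prod ∈ G (-n) :=
    C.mul_mem' (C.pow_mem D.F a) (C.list_prod_mem D.f l) (by push_cast [← hn']; ring)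
  have hy : E ^ b * (l'.map e).prod ∈ G n :=
    C.mul_mem' (C.pow_mem D.E b) (C.list_prod_mem D.e l') (by push_cast [← hn', hn]; ring)
  have he : e r ^ n ∈ G n := by simpa using C.pow_mem (D.e r) n
  have hf : f p ^ n ∈ G (-n) := by simpa using C.pow_mem (D.f p) n
  have hc : E ^ b * (l'.map e).prod * e r ^ n = e r ^ n * (E ^ b * (l'.map e).prod) :=
    (((R.Ee r).pow_pow b n).mul_left ((commute_list_prod (R.ee r) l').symm.pow_right n)).eq
  -- Multiplying by `e_r^n f_p^n`, whose value is nonzero, regroups the product into two weight zero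
  -- factors; the left one, `F^a f^l e_r^n`, is already known to be killed.
  have h1 : F ^ a * (l.map f).prod * E ^ b * (l'.map e).prod * (e r ^ n * f p ^ n) =
      F ^ a * (l.map f).prod * e r ^ n * (E ^ b * (l'.map e).prod * f p ^ n) := by
    rw [mul_assoc _ (E ^ b), mul_assoc, ← mul_assoc _ (e r ^ n), hc]
    simp only [mul_assoc]
  have h2 := congrArg Φ h1
  rw [C.map_mul _ _ _ (C.mul_mem' he hf (by ring)), C.map_mul _ _ (C.mul_mem' hx he (by ring))
    (C.mul_mem' hy hf (by ring)), map_F_pow_f_list_e_pow R C D h0 hrp a n l hn' (by omega),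
    zero_mul] at h2
  · exact (mul_eq_zero.1 h2).resolve_right (map_e_pow_f_pow_ne_zero R C D h0 hrp n)
  · rw [mul_assoc _ (E ^ b)]
    exact C.mul_mem' hx hy (by ring)

end Split

/-! ### Decoupling the oscillator part -/

section Weyl

variable {A : Type*} [Ring A] [Algebra ℂ A] {N : ℕ} {z : Matrix (Fin N) (Fin N) ℂ}
  {E F h : A} {e f : Fin N → A}

/-- The quadratic element `¼ eᵀ z⁻¹ e`. -/
def quad (z : Matrix (Fin N) (Fin N) ℂ) (e : Fin N → A) : A :=
  (1 / 4 : ℂ) • ∑ r, ∑ s, z⁻¹ r s • (e r * e s)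

/-- The weight element of the oscillator representation. -/
def oscWeight (z : Matrix (Fin N) (Fin N) ℂ) (e f : Fin N → A) : A :=
  (1 / 4 : ℂ) • ∑ r, ∑ s, z⁻¹ r s • (e r * f s + f r * e s)

lemma oscWeight_swap : oscWeight (-z) f e = -oscWeight z e f := by
  simp only [oscWeight, inv_neg_matrix, Matrix.neg_apply, neg_smul, Finset.sum_neg_distrib, smul_neg,
    add_comm (f _ * e _)]

lemma quad_neg : quad (-z) e = -quad z e := by
  simp only [quad, inv_neg_matrix, Matrix.neg_apply, neg_smul, Finset.sum_neg_distrib, smul_neg]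

lemma commute_quad {a : A} (h : ∀ r, Commute a (e r)) : Commute a (quad z e) :=
  (Commute.sum_right _ _ _ fun r _ => Commute.sum_right _ _ _ fun s _ =>
    ((h r).mul_right (h s)).smul_right _).smul_right _

lemma commute_oscWeight {a : A} (he : ∀ r, Commute a (e r)) (hf : ∀ r, Commute a (f r)) :
    Commute a (oscWeight z e f) :=
  (Commute.sum_right _ _ _ fun r _ => Commute.sum_right _ _ _ fun s _ =>
    (((he r).mul_right (hf s)).add_right ((hf r).mul_right (he s))).smul_right _).smul_right _

lemma isSymm_inv (hz : z.IsSymm) : z⁻¹.IsSymm := by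
  rw [Matrix.IsSymm, Matrix.transpose_nonsing_inv, hz.eq]

lemma sum_inv_left (hu : IsUnit z.det) (x : Fin N → A) (p : Fin N) :
    ∑ r, ∑ s, (z⁻¹ r s * z s p) • x r = x p := by
  simp_rw [← Finset.sum_smul, ← Matrix.mul_apply, Matrix.nonsing_inv_mul z hu, Matrix.one_apply,
    ite_smul, one_smul, zero_smul]
  simp

lemma sum_inv_right (hz : z.IsSymm) (hu : IsUnit z.det) (x : Fin N → A) (p : Fin N) :
    ∑ r, ∑ s, (z⁻¹ r s * z r p) • x s = x p := by
  rw [Finset.sum_comm]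
  simp_rw [(isSymm_inv hz).apply]
  exact sum_inv_left hu x p

/-- The factor `1/4` is chosen so that `ad (quad z e)` acts on the `f_p` exactly as `ad Ẽ` does: the
two contractions contribute `2 e_p` each, the second by symmetry of `z`. Hence the difference
commutes with `f_p`. -/
lemma WeylRel.quad_mul (R : WeylRel z e f) (hz : z.IsSymm) (hu : IsUnit z.det) (p : Fin N) :
    quad z e * f p = f p * quad z e - e p := by
  have h1 : ∀ r s, e r * e s * f p =
      f p * (e r * e s) - (2 : ℂ) • (z s p • e r + z r p • e s) := by
    intro r s
    rw [mul_assoc, R.ef, mul_sub, ← mul_assoc, R.ef]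
    simp only [sub_mul, smul_mul_assoc, mul_smul_comm, one_mul, mul_one, mul_assoc]
    module
  have h2 : ∑ r, ∑ s, z⁻¹ r s • (e r * e s * f p) =
      f p * (∑ r, ∑ s, z⁻¹ r s • (e r * e s)) - (4 : ℂ) • e p := by
    simp_rw [h1, smul_sub, Finset.sum_sub_distrib, Finset.mul_sum, mul_smul_comm,
      smul_comm _ (2 : ℂ), ← Finset.smul_sum, smul_add, Finset.sum_add_distrib, smul_smul,
      sum_inv_left hu, sum_inv_right hz hu]
    module
  simp_rw [quad, smul_mul_assoc, Finset.sum_mul, smul_mul_assoc, h2, mul_smul_comm]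
  module

lemma WeylRel.oscWeight_mul_e (R : WeylRel z e f) (hz : z.IsSymm) (hu : IsUnit z.det) (p : Fin N) :
    oscWeight z e f * e p = e p * oscWeight z e f + e p := by
  have h1 : ∀ r s, (e r * f s + f r * e s) * e p =
      e p * (e r * f s + f r * e s) + (2 : ℂ) • (z s p • e r + z r p • e s) := by
    intro r s
    have a1 : f s * e p = e p * f s + (2 * z p s) • 1 := by rw [R.ef]; abel
    have a2 : f r * e p = e p * f r + (2 * z p r) • 1 := by rw [R.ef]; abel
    rw [add_mul, mul_assoc, a1, mul_assoc, (R.ee s p).eq, ← mul_assoc, a2, mul_add, ← mul_assoc,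
      (R.ee r p).eq, hz.apply s p, hz.apply r p]
    simp only [mul_add, add_mul, smul_mul_assoc, mul_smul_comm, one_mul, mul_one, mul_assoc]
    module
  have h2 : ∑ r, ∑ s, z⁻¹ r s • ((e r * f s + f r * e s) * e p) =
      e p * (∑ r, ∑ s, z⁻¹ r s • (e r * f s + f r * e s)) + (4 : ℂ) • e p := by
    simp_rw [h1, smul_add (M := ℂ) (A := A) _ (e p * _), Finset.sum_add_distrib, Finset.mul_sum,
      mul_smul_comm, smul_comm _ (2 : ℂ), ← Finset.smul_sum, smul_add, Finset.sum_add_distrib,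
      smul_smul, sum_inv_left hu, sum_inv_right hz hu]
    module
  simp_rw [oscWeight, smul_mul_assoc, Finset.sum_mul, smul_mul_assoc, h2, mul_smul_comm]
  module

lemma WeylRel.oscWeight_mul_f (R : WeylRel z e f) (hz : z.IsSymm) (hu : IsUnit z.det) (p : Fin N) :
    oscWeight z e f * f p = f p * oscWeight z e f - f p := by
  have hu' : IsUnit (-z).det := by simpa [Matrix.det_neg, isUnit_iff_ne_zero] using hu
  have := (R.swap hz).oscWeight_mul_e hz.neg hu' p
  rw [oscWeight_swap, neg_mul, mul_neg] at this
  rw [← neg_inj, this]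
  abel

lemma quad_weight {w : ℂ} (he : ∀ p, h * e p = e p * h + w • e p) :
    h * quad z e = quad z e * h + (2 * w) • quad z e := by
  have h1 : ∀ r s, h * (e r * e s) = e r * e s * h + (2 * w) • (e r * e s) := by
    intro r s
    rw [← mul_assoc, he, add_mul, mul_assoc, he, mul_add, smul_mul_assoc, mul_smul_comm, mul_assoc]
    module
  simp_rw [quad, mul_smul_comm, smul_mul_assoc, Finset.mul_sum, Finset.sum_mul, mul_smul_comm,
    smul_mul_assoc, h1, smul_add, Finset.sum_add_distrib, smul_comm _ (2 * w), ← Finset.smul_sum]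
  module

/-- With `oscWeight_mul_e` and `oscWeight_mul_f`, this makes `quad z e`, `quad (-z) f` and
`oscWeight z e f` an `sl₂`-triple inside the Weyl algebra: the oscillator representation. -/
lemma WeylRel.quad_mul_quad (R : WeylRel z e f) (hz : z.IsSymm) (hu : IsUnit z.det) :
    quad z e * quad (-z) f = quad (-z) f * quad z e + oscWeight z e f := by
  have h1 : ∀ r s, quad z e * (f r * f s) = f r * f s * quad z e - (e r * f s + f r * e s) := by
    intro r s
    rw [← mul_assoc, R.quad_mul hz hu, sub_mul, mul_assoc, R.quad_mul hz hu, mul_sub, mul_assoc]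
    abel
  rw [quad_neg, mul_neg, neg_mul]
  rw [quad.eq_1 z f, mul_smul_comm, smul_mul_assoc]
  simp_rw [Finset.mul_sum, Finset.sum_mul, mul_smul_comm, smul_mul_assoc, h1, smul_sub,
    Finset.sum_sub_distrib, oscWeight]
  module

/-- The relations of the Jacobi Lie algebra for `E = Ẽ`, `F = F̃`, `h = H̃`, `e_r = ẽ_r`,
`f_r = f̃_r`, with `Z̃_{rs}` the scalars `z_{rs}`. -/
structure JacobiRel (z : Matrix (Fin N) (Fin N) ℂ) (E F h : A) (e f : Fin N → A) : Prop
    extends WeylRel z e f where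
  Ee : ∀ r, Commute E (e r)
  Ff : ∀ r, Commute F (f r)
  Ef : ∀ r, E * f r = f r * E - e r
  Fe : ∀ r, F * e r = e r * F - f r
  EF : E * F = F * E + h
  he : ∀ r, h * e r = e r * h + e r
  hf : ∀ r, h * f r = f r * h - f r
  hE : h * E = E * h + (2 : ℂ) • E
  hF : h * F = F * h - (2 : ℂ) • F

lemma JacobiRel.split (R : JacobiRel z E F h e f) (hz : z.IsSymm) (hu : IsUnit z.det) :
    SplitRel z (E - quad z e) (F - quad (-z) f) h e f := by
  have hu' : IsUnit (-z).det := by simpa [Matrix.det_neg, isUnit_iff_ne_zero] using hu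
  have Ee : ∀ r, Commute (E - quad z e) (e r) := fun r =>
    (R.Ee r).sub_left (commute_quad fun s => R.ee r s).symm
  have Ef : ∀ r, Commute (E - quad z e) (f r) := fun r => by
    rw [Commute, SemiconjBy, sub_mul, R.Ef, R.quad_mul hz hu, mul_sub]
    abel
  have Fe : ∀ r, Commute (F - quad (-z) f) (e r) := fun r => by
    rw [Commute, SemiconjBy, sub_mul, R.Fe, (R.toWeylRel.swap hz).quad_mul hz.neg hu', mul_sub]
    abel
  have h1 : h * quad z e = quad z e * h + (2 : ℂ) • quad z e := by
    have := quad_weight (z := z) (w := 1) (h := h) (e := e) fun p => by rw [R.he, one_smul]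
    rwa [mul_one] at this
  have h2 : h * quad (-z) f = quad (-z) f * h - (2 : ℂ) • quad (-z) f := by
    have := quad_weight (z := -z) (w := -1) (h := h) (e := f) fun p => by
      rw [R.hf, neg_one_smul, sub_eq_add_neg]
    rwa [mul_neg, mul_one, neg_smul, ← sub_eq_add_neg] at this
  refine ⟨R.toWeylRel, Ee, Ef, Fe, fun r => (R.Ff r).sub_left (commute_quad fun s => R.ff r s).symm,
    ?_, R.he, R.hf, ?_, ?_⟩
  · have h3 : (E - quad z e) * quad (-z) f = quad (-z) f * (E - quad z e) := (commute_quad Ef).eq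
    have h4 : quad z e * (F - quad (-z) f) = (F - quad (-z) f) * quad z e :=
      (commute_quad Fe).eq.symm
    have h5 := R.toWeylRel.quad_mul_quad hz hu
    change _ = _ - oscWeight z e f
    -- Write `q`, `q'` for the two quadratic elements. As `E - q` commutes with the `f_r` and `F -
    -- q'` with the `e_r`, both `[E, q']` and `[q, F]` equal `[q, q']`; so `[E - q, F - q'] = [E, F]
    -- - [q, q']`. The terms are grouped so that these equalities cancel the last two brackets.
    have h6 : (E - quad z e) * (F - quad (-z) f) = (F - quad (-z) f) * (E - quad z e) +
        (E * F - F * E) - (quad z e * quad (-z) f - quad (-z) f * quad z e) +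
        ((quad z e * quad (-z) f - quad (-z) f * quad z e) -
          (E * quad (-z) f - quad (-z) f * E)) +
        ((quad z e * quad (-z) f - quad (-z) f * quad z e)
          - (quad z e * F - F * quad z e)) := by noncomm_ring
    have h7 : E * quad (-z) f - quad (-z) f * E =
        quad z e * quad (-z) f - quad (-z) f * quad z e := by
      rw [sub_mul, mul_sub] at h3
      rw [← sub_eq_zero] at h3 ⊢
      rw [← h3]
      abel
    have h8 : quad z e * F - F * quad z e =
        quad z e * quad (-z) f - quad (-z) f * quad z e := by
      rw [sub_mul, mul_sub] at h4
      rw [← sub_eq_zero] at h4 ⊢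
      rw [← h4]
      abel
    rw [h6, h7, h8, R.EF, h5]
    abel
  · rw [mul_sub, R.hE, h1, sub_mul, smul_sub]
    abel
  · rw [mul_sub, R.hF, h2, sub_mul, smul_sub]
    abel

/-- The relations of `sl₂`, with an `sl₂` that commutes with a Weyl algebra. -/
structure DecoupledRel (z : Matrix (Fin N) (Fin N) ℂ) (E F h : A) (e f : Fin N → A) : Prop
    extends WeylRel z e f where
  Ee : ∀ r, Commute E (e r)
  Ef : ∀ r, Commute E (f r)
  Fe : ∀ r, Commute F (e r)
  Ff : ∀ r, Commute F (f r)
  he : ∀ r, Commute h (e r)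
  hf : ∀ r, Commute h (f r)
  EF : E * F = F * E + h
  hE : h * E = E * h + (2 : ℂ) • E
  hF : h * F = F * h - (2 : ℂ) • F

/-- The reverse of `JacobiRel.split`: adding the oscillator triple to a commuting `sl₂` produces the
Jacobi relations, so modules can be built as tensor products. -/
lemma DecoupledRel.jacobi (R : DecoupledRel z E F h e f) (hz : z.IsSymm) (hu : IsUnit z.det) :
    JacobiRel z (E + quad z e) (F + quad (-z) f) (h + oscWeight z e f) e f := by
  have hu' : IsUnit (-z).det := by simpa [Matrix.det_neg, isUnit_iff_ne_zero] using hu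
  have h1 : oscWeight z e f * quad z e = quad z e * oscWeight z e f + (2 : ℂ) • quad z e := by
    have := quad_weight (z := z) (w := 1) (h := oscWeight z e f) (e := e) fun p => by
      rw [R.oscWeight_mul_e hz hu, one_smul]
    rwa [mul_one] at this
  have h2 : oscWeight z e f * quad (-z) f =
      quad (-z) f * oscWeight z e f - (2 : ℂ) • quad (-z) f := by
    have := quad_weight (z := -z) (w := -1) (h := oscWeight z e f) (e := f) fun p => by
      rw [R.oscWeight_mul_f hz hu, neg_one_smul, sub_eq_add_neg]
    rwa [mul_neg, mul_one, neg_smul, ← sub_eq_add_neg] at this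
  have cE := (commute_oscWeight (z := z) R.Ee R.Ef).eq
  have cF := (commute_oscWeight (z := z) R.Fe R.Ff).eq
  have ch := (commute_quad (z := z) R.he).eq
  have ch' := (commute_quad (z := -z) R.hf).eq
  have cEq := (commute_quad (z := -z) R.Ef).eq
  have cFq := (commute_quad (z := z) R.Fe).eq
  refine ⟨R.toWeylRel, fun r => (R.Ee r).add_left (commute_quad fun s => R.ee r s).symm,
    fun r => (R.Ff r).add_left (commute_quad fun s => R.ff r s).symm, ?_, ?_, ?_, ?_, ?_, ?_, ?_⟩
  · intro r
    rw [add_mul, (R.Ef r).eq, R.quad_mul hz hu, mul_add]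
    abel
  · intro r
    rw [add_mul, (R.Fe r).eq, (R.toWeylRel.swap hz).quad_mul hz.neg hu', mul_add]
    abel
  · simp only [add_mul, mul_add]
    rw [R.EF, R.toWeylRel.quad_mul_quad hz hu, cEq, cFq]
    abel
  · intro r
    rw [add_mul, (R.he r).eq, R.oscWeight_mul_e hz hu, mul_add]
    abel
  · intro r
    rw [add_mul, (R.hf r).eq, R.oscWeight_mul_f hz hu, mul_add]
    abel
  · simp only [add_mul, mul_add]
    rw [R.hE, h1, ch, ← cE, smul_add]
    abel
  · simp only [add_mul, mul_add]
    rw [R.hF, h2, ch', ← cF, smul_add]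
    abel

end Weyl

/-! ### The Jacobi Lie algebra in the tilde basis -/

section Basis

variable {N : ℕ}

lemma lie_et_et (r s : Fin N) : ⁅et r, et s⁆ = 0 := by
  ext i j
  · simp [et, e, f]
  · simp [et, e, f]
  · simp [et, e, f, J, Matrix.single_apply]
    split_ifs <;> ring

lemma lie_ft_ft (r s : Fin N) : ⁅ft r, ft s⁆ = 0 := by
  ext i j
  · simp [ft, e, f]
  · simp [ft, e, f]
  · simp [ft, e, f, J, Matrix.single_apply]
    split_ifs <;> ring

lemma lie_et_ft (r s : Fin N) : ⁅et r, ft s⁆ = (-2 : ℂ) • Zt r s := by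
  ext i j
  · simp [et, ft, e, f, Zt, Z]
  · simp [et, ft, e, f, Zt, Z]
  · simp [et, ft, e, f, Zt, Z, J, Matrix.single_apply]
    split_ifs <;> ring

lemma lie_Et_et (r : Fin N) : ⁅Et N, et r⁆ = 0 := by
  ext i j
  · simp [et, Et, e, f, E, F, H]
  · fin_cases j <;>
      simp [et, Et, e, f, E, F, H, Matrix.mul_apply, Matrix.single_apply, Fin.sum_univ_two] <;>
      split_ifs <;>
      first | ring1 | linear_combination (1 / 4 : ℂ) * Complex.I_mul_I |
        linear_combination (-1 / 4 : ℂ) * Complex.I_mul_I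
  · simp [et, Et, e, f, E, F, H]

lemma lie_Ft_ft (r : Fin N) : ⁅Ft N, ft r⁆ = 0 := by
  ext i j
  · simp [ft, Ft, e, f, E, F, H]
  · fin_cases j <;>
      simp [ft, Ft, e, f, E, F, H, Matrix.mul_apply, Matrix.single_apply, Fin.sum_univ_two] <;>
      split_ifs <;>
      first | ring1 | linear_combination (1 / 4 : ℂ) * Complex.I_mul_I |
        linear_combination (-1 / 2 : ℂ) * Complex.I_mul_I
  · simp [ft, Ft, e, f, E, F, H]

lemma lie_Et_ft (r : Fin N) : ⁅Et N, ft r⁆ = -et r := by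
  ext i j
  · simp [et, ft, Et, e, f, E, F, H]
  · fin_cases j <;>
      simp [et, ft, Et, e, f, E, F, H, Matrix.mul_apply, Matrix.single_apply, Fin.sum_univ_two] <;>
      split_ifs <;> first | ring1 | linear_combination (1 / 4 : ℂ) * Complex.I_mul_I
  · simp [et, ft, Et, e, f, E, F, H]

lemma lie_Ft_et (r : Fin N) : ⁅Ft N, et r⁆ = -ft r := by
  ext i j
  · simp [et, ft, Ft, e, f, E, F, H]
  · fin_cases j <;>
      simp [et, ft, Ft, e, f, E, F, H, Matrix.mul_apply, Matrix.single_apply, Fin.sum_univ_two] <;>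
      split_ifs <;> first | ring1 | linear_combination (1 / 4 : ℂ) * Complex.I_mul_I
  · simp [et, ft, Ft, e, f, E, F, H]

lemma lie_Et_Ft : ⁅Et N, Ft N⁆ = Ht N := by
  ext i j
  · fin_cases i <;> fin_cases j <;> simp [Et, Ft, Ht, E, F, H] <;> ring
  · simp [Et, Ft, Ht, E, F, H]
  · simp [Et, Ft, Ht, E, F, H]

lemma Zt_central (r s : Fin N) (x : JacobiLie N) : ⁅Zt r s, x⁆ = 0 := by
  ext i j <;> simp [Zt, Z]

/-- The coefficient of `Ẽ`. -/
def coordE (x : JacobiLie N) : ℂ := x.M 0 0 - Complex.I / 2 * (x.M 0 1 + x.M 1 0)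
/-- The coefficient of `F̃`. -/
def coordF (x : JacobiLie N) : ℂ := x.M 0 0 + Complex.I / 2 * (x.M 0 1 + x.M 1 0)
/-- The coefficient of `H̃`. -/
def coordH (x : JacobiLie N) : ℂ := Complex.I / 2 * (x.M 0 1 - x.M 1 0)
/-- The coefficient of `ẽ_r`. -/
def coorde (x : JacobiLie N) (r : Fin N) : ℂ := x.X r 0 - Complex.I * x.X r 1
/-- The coefficient of `f̃_r`. -/
def coordf (x : JacobiLie N) (r : Fin N) : ℂ := x.X r 0 + Complex.I * x.X r 1

/-- The expansion of an element in the tilde basis. -/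
lemma eq_sum_tilde (x : JacobiLie N) :
    x = coordH x • Ht N + coordE x • Et N + coordF x • Ft N + ∑ r, coorde x r • et r +
      ∑ r, coordf x r • ft r + ∑ r, ∑ s, (-2 * Complex.I * x.κ r s) • Zt r s := by
  -- The components are bundled as additive maps so that they pass through the finite sums.
  let pM : JacobiLie N →+ Matrix (Fin 2) (Fin 2) ℂ := ⟨⟨JacobiLie.M, rfl⟩, fun _ _ => rfl⟩
  let pX : JacobiLie N →+ Matrix (Fin N) (Fin 2) ℂ := ⟨⟨JacobiLie.X, rfl⟩, fun _ _ => rfl⟩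
  let pκ : JacobiLie N →+ Matrix (Fin N) (Fin N) ℂ := ⟨⟨JacobiLie.κ, rfl⟩, fun _ _ => rfl⟩
  have hM : ∀ (g : Fin N → JacobiLie N), (∑ r, g r).M = ∑ r, (g r).M := fun g => map_sum pM g _
  have hX : ∀ (g : Fin N → JacobiLie N), (∑ r, g r).X = ∑ r, (g r).X := fun g => map_sum pX g _
  have hκ : ∀ (g : Fin N → JacobiLie N), (∑ r, g r).κ = ∑ r, (g r).κ := fun g => map_sum pκ g _
  have htr : x.M 1 1 = -x.M 0 0 := by
    have := x.trace_M
    rw [Matrix.trace_fin_two] at this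
    linear_combination this
  have hI := Complex.I_mul_I
  have hI2 := Complex.I_sq
  ext i j
  · fin_cases i <;> fin_cases j <;>
      simp [hM, et, ft, Et, Ft, Ht, e, f, E, F, H, Zt, Z, coordE, coordF, coordH, htr] <;>
      ring_nf <;> simp [hI2]
  · fin_cases j <;>
      simp [hX, et, ft, Et, Ft, Ht, e, f, E, F, H, Zt, Z, coorde, coordf, Matrix.sum_apply,
        Matrix.single_apply] <;>
      ring_nf <;> simp [hI2]
  · have hs : x.κ j i = x.κ i j := congrFun (congrFun x.κ_transpose i) j
    simp [hκ, et, ft, Et, Ft, Ht, e, f, E, F, H, Zt, Z, Matrix.sum_apply,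
        Matrix.single_apply, Finset.sum_add_distrib, ite_and, hs]
    linear_combination x.κ i j * hI

end Basis

/-! ### Representations of the Jacobi Lie algebra with scalar center -/

section Rep

variable {A : Type*} [Ring A] [Algebra ℂ A] {N : ℕ} {z : Matrix (Fin N) (Fin N) ℂ}
  {E' F' h : A} {a b : Fin N → A}

lemma ι_lie (x y : JacobiLie N) : ι x * ι y = ι y * ι x + ι ⁅x, y⁆ := by
  simp only [ι]
  rw [LieHom.map_lie, LieRing.of_associative_ring_bracket]
  abel

lemma ι_smul (c : ℂ) (x : JacobiLie N) : ι (c • x) = c • ι x := map_smul _ _ _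

lemma ι_neg (x : JacobiLie N) : ι (-x) = -ι x := map_neg (UniversalEnvelopingAlgebra.ι ℂ) _

lemma ι_zero : ι (0 : JacobiLie N) = 0 := map_zero (UniversalEnvelopingAlgebra.ι ℂ)

lemma ι_eq_sum (x : JacobiLie N) :
    ι x = coordH x • ι (Ht N) + coordE x • ι (Et N) + coordF x • ι (Ft N) +
      ∑ r, coorde x r • ι (et r) + ∑ r, coordf x r • ι (ft r) +
      ∑ r, ∑ s, (-2 * Complex.I * x.κ r s) • ι (Zt r s) := by
  conv_lhs => rw [eq_sum_tilde x]
  simp only [ι, map_add, map_smul, map_sum]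

lemma Ht_mul {w : ℤ} {u : U N} (hu : HasWeight w u) :
    ι (Ht N) * u = u * ι (Ht N) + (w : ℂ) • u := by
  have h1 := hu (Ht N) (Ht_mem N)
  have h2 : -Complex.I * (Ht N).M 1 0 = 1 := by simp [Ht, E, F]
  rwa [h2, mul_one] at h1

lemma jacobiRel_of_algHom (ρ : U N →ₐ[ℂ] A)
    (hρ : ∀ r s, ρ (ι (Zt r s)) = algebraMap ℂ A (z r s)) :
    JacobiRel z (ρ (ι (Et N))) (ρ (ι (Ft N))) (ρ (ι (Ht N))) (fun r => ρ (ι (et r)))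
      (fun r => ρ (ι (ft r))) where
  ee r s := by
    rw [Commute, SemiconjBy, ← map_mul, ι_lie, lie_et_et, ι_zero, add_zero, map_mul]
  ff r s := by
    rw [Commute, SemiconjBy, ← map_mul, ι_lie, lie_ft_ft, ι_zero, add_zero, map_mul]
  ef r s := by
    rw [← map_mul, ι_lie, lie_et_ft, ι_smul, map_add, map_smul, hρ, map_mul,
      Algebra.algebraMap_eq_smul_one]
    module
  Ee r := by
    rw [Commute, SemiconjBy, ← map_mul, ι_lie, lie_Et_et, ι_zero, add_zero, map_mul]
  Ff r := by
    rw [Commute, SemiconjBy, ← map_mul, ι_lie, lie_Ft_ft, ι_zero, add_zero, map_mul]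
  Ef r := by
    rw [← map_mul, ι_lie, lie_Et_ft, ι_neg, map_add, map_neg, map_mul, sub_eq_add_neg]
  Fe r := by
    rw [← map_mul, ι_lie, lie_Ft_et, ι_neg, map_add, map_neg, map_mul, sub_eq_add_neg]
  EF := by
    rw [← map_mul, ι_lie, lie_Et_Ft, map_add, map_mul]
  he r := by
    rw [← map_mul, Ht_mul (hasWeight_et r), map_add, map_smul, map_mul]
    simp
  hf r := by
    rw [← map_mul, Ht_mul (hasWeight_ft r), map_add, map_smul, map_mul]
    simp [sub_eq_add_neg]
  hE := by
    rw [← map_mul, Ht_mul (hasWeight_Et N), map_add, map_smul, map_mul]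
    simp
  hF := by
    rw [← map_mul, Ht_mul (hasWeight_Ft N), map_add, map_smul, map_mul]
    simp [sub_eq_add_neg]

lemma map_Enu {L : Matrix (Fin N) (Fin N) ℂ} (ρ : U N →ₐ[ℂ] A) :
    ρ (Enu L) = ρ (ι (Et N)) - quad (zMat L) (fun r => ρ (ι (et r))) := by
  simp only [Enu, quad, map_sub, map_smul, map_sum, map_mul]

lemma map_Fnu {L : Matrix (Fin N) (Fin N) ℂ} (ρ : U N →ₐ[ℂ] A) :
    ρ (Fnu L) = ρ (ι (Ft N)) - quad (-zMat L) (fun r => ρ (ι (ft r))) := by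
  rw [quad_neg, sub_neg_eq_add]
  simp only [Fnu, quad, map_add, map_smul, map_sum, map_mul]

lemma zMat_isSymm {L : Matrix (Fin N) (Fin N) ℂ} (hL : L.IsSymm) : (zMat L).IsSymm := hL.smul _

lemma zMat_isUnit {L : Matrix (Fin N) (Fin N) ℂ} (hL : IsUnit L.det) : IsUnit (zMat L).det := by
  rw [zMat, Matrix.det_smul]
  refine IsUnit.mul (IsUnit.pow _ ?_) hL
  simp [isUnit_iff_ne_zero, Real.pi_ne_zero]

/-- On a module on which `Z̃` acts by the scalar matrix `-πL` the relations decouple. -/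
lemma splitRel_of_algHom {L : Matrix (Fin N) (Fin N) ℂ} (hsymm : L.IsSymm) (hinv : IsUnit L.det)
    (ρ : U N →ₐ[ℂ] A) (hρ : ∀ r s, ρ (ι (Zt r s)) = algebraMap ℂ A (zMat L r s)) :
    SplitRel (zMat L) (ρ (Enu L)) (ρ (Fnu L)) (ρ (ι (Ht N))) (fun r => ρ (ι (et r)))
      (fun r => ρ (ι (ft r))) := by
  rw [map_Enu, map_Fnu]
  exact (jacobiRel_of_algHom ρ hρ).split (zMat_isSymm hsymm) (zMat_isUnit hinv)

/-- The linear map underlying the representation defined by elements satisfying the relations of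
the Jacobi Lie algebra. -/
def repLin (z : Matrix (Fin N) (Fin N) ℂ) (E' F' h : A) (a b : Fin N → A) :
    JacobiLie N →ₗ[ℂ] A where
  toFun x := coordH x • h + coordE x • E' + coordF x • F' + ∑ r, coorde x r • a r +
    ∑ r, coordf x r • b r + (∑ r, ∑ s, -2 * Complex.I * x.κ r s * z r s) • 1
  map_add' x y := by
    simp only [coordH, coordE, coordF, coorde, coordf, add_M, add_X, add_κ, Matrix.add_apply, mul_add,
      add_mul, add_smul, sub_smul, Finset.sum_add_distrib, Finset.sum_sub_distrib, mul_sub]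
    abel
  map_smul' c x := by
    simp only [coordH, coordE, coordF, coorde, coordf, smul_M, smul_X, smul_κ, Matrix.smul_apply,
      smul_eq_mul, RingHom.id_apply, smul_add, Finset.smul_sum, smul_smul, Finset.sum_smul]
    congr! 4 with r _ r _ r _ r _ s _
    all_goals ring_nf

lemma repLin_apply (x : JacobiLie N) : repLin z E' F' h a b x =
    coordH x • h + coordE x • E' + coordF x • F' + ∑ r, coorde x r • a r +
    ∑ r, coordf x r • b r + (∑ r, ∑ s, -2 * Complex.I * x.κ r s * z r s) • 1 := rfl

/-- These are the structure constants in tilde coordinates. The central coefficient carries `-2i`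
because `Z̃ = (i/2) Z`. -/
lemma coord_lie (x y : JacobiLie N) :
    coordH ⁅x, y⁆ = coordE x * coordF y - coordF x * coordE y ∧
    coordE ⁅x, y⁆ = 2 * (coordH x * coordE y - coordE x * coordH y) ∧
    coordF ⁅x, y⁆ = 2 * (coordF x * coordH y - coordH x * coordF y) ∧
    (∀ r, coorde ⁅x, y⁆ r = coordH x * coorde y r - coordE x * coordf y r -
      (coordH y * coorde x r - coordE y * coordf x r)) ∧
    (∀ r, coordf ⁅x, y⁆ r = -coordH x * coordf y r - coordF x * coorde y r -
      (-coordH y * coordf x r - coordF y * coorde x r)) ∧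
    ∀ r s, -2 * Complex.I * ⁅x, y⁆.κ r s =
      (coordf x r * coorde y s + coorde y r * coordf x s) -
        (coorde x r * coordf y s + coordf y r * coorde x s) := by
  have hx : x.M 1 1 = -x.M 0 0 := by
    have := x.trace_M
    rw [Matrix.trace_fin_two] at this
    linear_combination this
  have hy : y.M 1 1 = -y.M 0 0 := by
    have := y.trace_M
    rw [Matrix.trace_fin_two] at this
    linear_combination this
  have hI := Complex.I_sq
  refine ⟨?_, ?_, ?_, fun r => ?_, fun r => ?_, fun r s => ?_⟩ <;>
    simp [coordH, coordE, coordF, coorde, coordf, Matrix.mul_apply, Fin.sum_univ_two, hx, hy, J] <;>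
    ring_nf <;> simp [hI] <;> ring

/-- By bilinearity only brackets of basis elements matter. The mixed brackets of the `a_r` and `b_s`
produce all of the central scalar, and matching it with `κ` paired against `z` uses the symmetry of
`z`. -/
lemma JacobiRel.map_lie (R : JacobiRel z E' F' h a b) (hz : z.IsSymm) (x y : JacobiLie N) :
    repLin z E' F' h a b ⁅x, y⁆ = ⁅repLin z E' F' h a b x, repLin z E' F' h a b y⁆ := by
  obtain ⟨c1, c2, c3, c4, c5, c6⟩ := coord_lie x y
  have bab : ∀ r s, ⁅a r, b s⁆ = (-2 * z r s) • (1 : A) := fun r s => by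
    rw [LieRing.of_associative_ring_bracket, R.ef]
    module
  have bba : ∀ s r, ⁅b s, a r⁆ = (2 * z r s) • (1 : A) := fun r s => by
    rw [← lie_skew, bab]
    module
  have baa : ∀ r s, ⁅a r, a s⁆ = 0 := fun r s => by
    rw [LieRing.of_associative_ring_bracket, (R.ee r s).eq, sub_self]
  have bbb : ∀ r s, ⁅b r, b s⁆ = 0 := fun r s => by
    rw [LieRing.of_associative_ring_bracket, (R.ff r s).eq, sub_self]
  have bEa : ∀ r, ⁅E', a r⁆ = 0 := fun r => by
    rw [LieRing.of_associative_ring_bracket, (R.Ee r).eq, sub_self]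
  have bFb : ∀ r, ⁅F', b r⁆ = 0 := fun r => by
    rw [LieRing.of_associative_ring_bracket, (R.Ff r).eq, sub_self]
  have bEb : ∀ r, ⁅E', b r⁆ = -a r := fun r => by
    rw [LieRing.of_associative_ring_bracket, R.Ef]
    abel
  have bFa : ∀ r, ⁅F', a r⁆ = -b r := fun r => by
    rw [LieRing.of_associative_ring_bracket, R.Fe]
    abel
  have bha : ∀ r, ⁅h, a r⁆ = a r := fun r => by
    rw [LieRing.of_associative_ring_bracket, R.he]
    abel
  have bhb : ∀ r, ⁅h, b r⁆ = -b r := fun r => by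
    rw [LieRing.of_associative_ring_bracket, R.hf]
    abel
  have bEF : ⁅E', F'⁆ = h := by
    rw [LieRing.of_associative_ring_bracket, R.EF]
    abel
  have bhE : ⁅h, E'⁆ = (2 : ℂ) • E' := by
    rw [LieRing.of_associative_ring_bracket, R.hE]
    abel
  have bhF : ⁅h, F'⁆ = (-2 : ℂ) • F' := by
    rw [LieRing.of_associative_ring_bracket, R.hF]
    module
  have bEh : ⁅E', h⁆ = (-2 : ℂ) • E' := by rw [← lie_skew, bhE]; module
  have bFh : ⁅F', h⁆ = (2 : ℂ) • F' := by rw [← lie_skew, bhF]; module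
  have bFE : ⁅F', E'⁆ = -h := by rw [← lie_skew, bEF]
  have b1 : ∀ u : A, ⁅u, (1 : A)⁆ = 0 := fun u => by
    rw [LieRing.of_associative_ring_bracket, mul_one, one_mul, sub_self]
  have b1' : ∀ u : A, ⁅(1 : A), u⁆ = 0 := fun u => by rw [← lie_skew, b1, neg_zero]
  have hκ : (∑ r, ∑ s, -2 * Complex.I * ⁅x, y⁆.κ r s * z r s) =
      ∑ r, ∑ s, coordf x r * coorde y s * (2 * z s r) +
      ∑ r, ∑ s, coorde x r * coordf y s * (-2 * z r s) := by
    have s1 : ∑ r, ∑ s, coorde y r * coordf x s * z r s =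
        ∑ r, ∑ s, coordf x r * coorde y s * z r s := by
      rw [Finset.sum_comm]
      refine Finset.sum_congr rfl fun r _ => Finset.sum_congr rfl fun s _ => ?_
      rw [hz.apply]
      ring
    have s2 : ∑ r, ∑ s, coordf y r * coorde x s * z r s =
        ∑ r, ∑ s, coorde x r * coordf y s * z r s := by
      rw [Finset.sum_comm]
      refine Finset.sum_congr rfl fun r _ => Finset.sum_congr rfl fun s _ => ?_
      rw [hz.apply]
      ring
    simp only [c6, sub_mul, add_mul, Finset.sum_sub_distrib, Finset.sum_add_distrib, s1, s2, hz.apply]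
    simp only [mul_left_comm _ (2 : ℂ), mul_left_comm _ (-2 : ℂ), ← Finset.mul_sum]
    ring
  have mixed : ⁅∑ r, coordf x r • b r, ∑ r, coorde y r • a r⁆ +
      ⁅∑ r, coorde x r • a r, ∑ r, coordf y r • b r⁆ =
      (∑ r, ∑ s, -2 * Complex.I * ⁅x, y⁆.κ r s * z r s) • (1 : A) := by
    simp only [sum_lie]
    simp only [lie_sum, lie_smul, smul_lie, bab, bba, hκ, add_smul, Finset.sum_smul, smul_smul]
    refine congrArg₂ _ (Finset.sum_congr rfl fun r _ => Finset.sum_congr rfl fun s _ => ?_)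
      (Finset.sum_congr rfl fun r _ => Finset.sum_congr rfl fun s _ => ?_)
    · congr 1
      ring
    · congr 1
      ring
  have split_e : ∑ r, coorde ⁅x, y⁆ r • a r =
      coordH x • ∑ r, coorde y r • a r - coordE x • ∑ r, coordf y r • a r -
        (coordH y • ∑ r, coorde x r • a r - coordE y • ∑ r, coordf x r • a r) := by
    simp only [c4, sub_smul, Finset.sum_sub_distrib, mul_smul, Finset.smul_sum]
  have split_f : ∑ r, coordf ⁅x, y⁆ r • b r =
      -coordH x • ∑ r, coordf y r • b r - coordF x • ∑ r, coorde y r • b r -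
        (-coordH y • ∑ r, coordf x r • b r - coordF y • ∑ r, coorde x r • b r) := by
    simp only [c5, sub_smul, Finset.sum_sub_distrib, mul_smul, Finset.smul_sum]
  have left_lie : ∀ (u : A) (v w : Fin N → A) (c : Fin N → ℂ) (t : ℂ), (∀ r, ⁅u, v r⁆ = t • w r) →
      ⁅u, ∑ r, c r • v r⁆ = t • ∑ r, c r • w r := by
    intro u v w c t huv
    simp only [lie_sum, lie_smul, huv, Finset.smul_sum, smul_comm t]
  have right_lie : ∀ (u : A) (v w : Fin N → A) (c : Fin N → ℂ) (t : ℂ), (∀ r, ⁅u, v r⁆ = t • w r) →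
      ⁅∑ r, c r • v r, u⁆ = -t • ∑ r, c r • w r := by
    intro u v w c t huv
    rw [← lie_skew, left_lie u v w c t huv, neg_smul]
  have pha : ∀ r, ⁅h, a r⁆ = (1 : ℂ) • a r := fun r => by rw [bha, one_smul]
  have phb : ∀ r, ⁅h, b r⁆ = (-1 : ℂ) • b r := fun r => by rw [bhb, neg_one_smul]
  have pEa : ∀ r, ⁅E', a r⁆ = (0 : ℂ) • a r := fun r => by rw [bEa, zero_smul]
  have pEb : ∀ r, ⁅E', b r⁆ = (-1 : ℂ) • a r := fun r => by rw [bEb, neg_one_smul]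
  have pFa : ∀ r, ⁅F', a r⁆ = (-1 : ℂ) • b r := fun r => by rw [bFa, neg_one_smul]
  have pFb : ∀ r, ⁅F', b r⁆ = (0 : ℂ) • b r := fun r => by rw [bFb, zero_smul]
  have paa : ∀ c d : Fin N → ℂ, ⁅∑ r, c r • a r, ∑ r, d r • a r⁆ = 0 := by
    intro c d
    simp only [sum_lie, lie_sum, lie_smul, smul_lie, baa, smul_zero, Finset.sum_const_zero]
  have pbb : ∀ c d : Fin N → ℂ, ⁅∑ r, c r • b r, ∑ r, d r • b r⁆ = 0 := by
    intro c d
    simp only [sum_lie, lie_sum, lie_smul, smul_lie, bbb, smul_zero, Finset.sum_const_zero]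
  rw [repLin_apply, ← mixed, c1, c2, c3, split_e, split_f]
  simp only [repLin_apply, lie_add, add_lie, lie_smul, smul_lie, bEF, bhE, bhF, bEh, bFh, bFE,
    b1, b1', lie_self, smul_zero, add_zero, zero_add, left_lie _ _ _ _ _ pha, left_lie _ _ _ _ _ phb,
    left_lie _ _ _ _ _ pEa, left_lie _ _ _ _ _ pEb, left_lie _ _ _ _ _ pFa,
    left_lie _ _ _ _ _ pFb, right_lie _ _ _ _ _ pha, right_lie _ _ _ _ _ phb,
    right_lie _ _ _ _ _ pEa, right_lie _ _ _ _ _ pEb, right_lie _ _ _ _ _ pFa,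
    right_lie _ _ _ _ _ pFb, paa, pbb]
  module

lemma repLin_Et : repLin z E' F' h a b (Et N) = E' := by
  have h1 : coordE (Et N) = 1 := by
    simp [coordE, Et, E, F, H]
    linear_combination (-1 / 2 : ℂ) * Complex.I_mul_I
  have h2 : coordF (Et N) = 0 := by
    simp [coordF, Et, E, F, H]
    linear_combination (1 / 2 : ℂ) * Complex.I_mul_I
  have h3 : coordH (Et N) = 0 := by simp [coordH, Et, E, F, H]
  rw [repLin_apply, h1, h2, h3]
  simp [coorde, coordf, Et, E, F, H]

lemma repLin_Ft : repLin z E' F' h a b (Ft N) = F' := by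
  have h1 : coordF (Ft N) = 1 := by
    simp [coordF, Ft, E, F, H]
    linear_combination (-1 / 2 : ℂ) * Complex.I_mul_I
  have h2 : coordE (Ft N) = 0 := by
    simp [coordE, Ft, E, F, H]
    linear_combination (1 / 2 : ℂ) * Complex.I_mul_I
  have h3 : coordH (Ft N) = 0 := by simp [coordH, Ft, E, F, H]
  rw [repLin_apply, h1, h2, h3]
  simp [coorde, coordf, Ft, E, F, H]

lemma repLin_et (r : Fin N) : repLin z E' F' h a b (et r) = a r := by
  have h1 : ∀ s, coorde (et r) s = if r = s then 1 else 0 := fun s => by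
    simp [coorde, et, e, f, Matrix.single_apply]
    split_ifs
    · linear_combination (-1 / 2 : ℂ) * Complex.I_mul_I
    · ring
  have h2 : ∀ s, coordf (et r) s = 0 := fun s => by
    simp [coordf, et, e, f, Matrix.single_apply]
    split_ifs
    · linear_combination (1 / 2 : ℂ) * Complex.I_mul_I
    · ring
  rw [repLin_apply]
  simp only [h1, h2]
  simp [coordE, coordF, coordH, et, e, f]

lemma repLin_ft (r : Fin N) : repLin z E' F' h a b (ft r) = b r := by
  have h1 : ∀ s, coordf (ft r) s = if r = s then 1 else 0 := fun s => by
    simp [coordf, ft, e, f, Matrix.single_apply]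
    split_ifs
    · linear_combination (-1 / 2 : ℂ) * Complex.I_mul_I
    · ring
  have h2 : ∀ s, coorde (ft r) s = 0 := fun s => by
    simp [coorde, ft, e, f, Matrix.single_apply]
    split_ifs
    · linear_combination (1 / 2 : ℂ) * Complex.I_mul_I
    · ring
  rw [repLin_apply]
  simp only [h1, h2]
  simp [coordE, coordF, coordH, ft, e, f]

/-- The action of an element of the stabilizer subalgebra. -/
lemma repLin_stab {L : Matrix (Fin N) (Fin N) ℂ} (hL : L.IsSymm) (k : ℂ) (Y : stab N) :
    repLin (zMat L) E' F' h a b Y = (-Complex.I * Y.1.M 1 0) • (h - k • 1) - (char k L Y) • 1 := by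
  obtain ⟨Y, hY⟩ := Y
  obtain ⟨t, hM, hX⟩ := stab_shape hY
  have h1 : coordE Y = 0 := by simp [coordE, hM]
  have h2 : coordF Y = 0 := by simp [coordF, hM]
  have h3 : coordH Y = -Complex.I * Y.M 1 0 := by
    simp [coordH, hM]
    ring
  have h4 : ∀ r, coorde Y r = 0 := fun r => by simp [coorde, hX]
  have h5 : ∀ r, coordf Y r = 0 := fun r => by simp [coordf, hX]
  have h6 : (∑ r, ∑ s, -2 * Complex.I * Y.κ r s * zMat L r s) =
      2 * Real.pi * Complex.I * (Y.κ * L).trace := by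
    simp only [Matrix.trace, Matrix.diag, Matrix.mul_apply, Finset.mul_sum]
    refine Finset.sum_congr rfl fun r _ => Finset.sum_congr rfl fun s _ => ?_
    rw [zMat, Matrix.smul_apply, smul_eq_mul, hL.apply]
    ring
  rw [repLin_apply, h1, h2, h3, h6]
  simp only [h4, h5, zero_smul, Finset.sum_const_zero, add_zero, char, LinearMap.coe_mk,
    AddHom.coe_mk]
  module

/-- The representation of the enveloping algebra defined by elements satisfying the relations of
the Jacobi Lie algebra. -/
def JacobiRel.rep (R : JacobiRel z E' F' h a b) (hz : z.IsSymm) : U N →ₐ[ℂ] A :=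
  UniversalEnvelopingAlgebra.lift ℂ
    { repLin z E' F' h a b with map_lie' := fun {x y} => R.map_lie hz x y }

lemma JacobiRel.rep_ι (R : JacobiRel z E' F' h a b) (hz : z.IsSymm) (x : JacobiLie N) :
    R.rep hz (ι x) = repLin z E' F' h a b x := by
  rw [JacobiRel.rep, ι, UniversalEnvelopingAlgebra.lift_ι_apply]
  rfl

end Rep

/-! ### Normally ordered monomials span cyclic modules -/

section Span

variable {V : Type*} [AddCommGroup V] [Module ℂ V] {N : ℕ} {z : Matrix (Fin N) (Fin N) ℂ}
  {E F h : Module.End ℂ V} {e f : Fin N → Module.End ℂ V} {v : V} {k : ℂ}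

/-- The normally ordered monomials in an associative algebra. -/
def ordMon {A : Type*} [Ring A] (E F : A) (e f : Fin N → A) (a b : ℕ) (l l' : List (Fin N)) : A :=
  F ^ a * (l.map f).prod * E ^ b * (l'.map e).prod

/-- The span of the normally ordered monomials applied to a vector. -/
def ordSpan (E F : Module.End ℂ V) (e f : Fin N → Module.End ℂ V) (v : V) : Submodule ℂ V :=
  Submodule.span ℂ {x | ∃ a b l l', x = ordMon E F e f a b l l' v}

lemma ordMon_mem (a b : ℕ) (l l' : List (Fin N)) :
    ordMon E F e f a b l l' v ∈ ordSpan E F e f v :=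
  Submodule.subset_span ⟨a, b, l, l', rfl⟩

lemma ordSpan_stable {T : Module.End ℂ V}
    (hT : ∀ a b l l', (T * ordMon E F e f a b l l') v ∈ ordSpan E F e f v) :
    ∀ x ∈ ordSpan E F e f v, T x ∈ ordSpan E F e f v := by
  intro x hx
  have : ordSpan E F e f v ≤ (ordSpan E F e f v).comap T := by
    refine Submodule.span_le.2 ?_
    rintro _ ⟨a, b, l, l', rfl⟩
    exact hT a b l l'
  exact this hx

lemma ordSpan_F : ∀ x ∈ ordSpan E F e f v, F x ∈ ordSpan E F e f v := by
  refine ordSpan_stable fun a b l l' => ?_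
  have : F * ordMon E F e f a b l l' = ordMon E F e f (a + 1) b l l' := by
    simp only [ordMon, pow_succ', mul_assoc]
  rw [this]
  exact ordMon_mem _ _ _ _

lemma ordSpan_f (R : SplitRel z E F h e f) (r : Fin N) :
    ∀ x ∈ ordSpan E F e f v, f r x ∈ ordSpan E F e f v := by
  refine ordSpan_stable fun a b l l' => ?_
  have : f r * ordMon E F e f a b l l' = ordMon E F e f a b (r :: l) l' := by
    simp only [ordMon, List.map_cons, List.prod_cons, ← mul_assoc, ((R.Ff r).pow_left a).eq]
  rw [this]
  exact ordMon_mem _ _ _ _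

lemma ordSpan_e (R : SplitRel z E F h e f) (r : Fin N) :
    ∀ x ∈ ordSpan E F e f v, e r x ∈ ordSpan E F e f v := by
  -- The list `p` holds the letters `f` that `e r` has already crossed, `l` those still ahead. Each
  -- crossing leaves a scalar multiple of an ordered monomial.
  have key : ∀ (a b : ℕ) (l p l' : List (Fin N)), (F ^ a * (p.map f).prod * e r * (l.map f).prod *
      E ^ b * (l'.map e).prod) v ∈ ordSpan E F e f v := by
    intro a b l l'
    induction l generalizing l' with
    | nil =>
      intro l''
      have : F ^ a * (l'.map f).prod * e r * (([] : List (Fin N)).map f).prod * E ^ b *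
          (l''.map e).prod = ordMon E F e f a b l' (r :: l'') := by
        simp only [ordMon, List.map_nil, List.prod_nil, mul_one, List.map_cons, List.prod_cons]
        rw [mul_assoc _ (e r), ← ((R.Ee r).pow_left b).eq]
        simp only [mul_assoc]
      rw [this]
      exact ordMon_mem _ _ _ _
    | cons s l ih =>
      intro l''
      have : F ^ a * (l'.map f).prod * e r * ((s :: l).map f).prod * E ^ b * (l''.map e).prod =
          F ^ a * ((l' ++ [s]).map f).prod * e r * (l.map f).prod * E ^ b * (l''.map e).prod -
            (2 * z r s) • ordMon E F e f a b (l' ++ l) l'' := by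
        simp only [ordMon, List.map_cons, List.prod_cons, List.map_append, List.prod_append,
          List.map_nil, List.prod_nil, mul_one]
        rw [← mul_assoc _ (f s), mul_assoc _ (e r) (f s), R.ef]
        simp only [mul_sub, sub_mul, mul_assoc, mul_smul_comm, smul_mul_assoc, one_mul]
      rw [this]
      exact Submodule.sub_mem _ (ih _ _) (Submodule.smul_mem _ _ (ordMon_mem _ _ _ _))
  refine ordSpan_stable fun a b l l' => ?_
  have h1 := key a b l [] l'
  have : e r * ordMon E F e f a b l l' =
      F ^ a * (([] : List (Fin N)).map f).prod * e r * (l.map f).prod * E ^ b * (l'.map e).prod := by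
    simp only [ordMon, List.map_nil, List.prod_nil, mul_one, ← mul_assoc, ((R.Fe r).pow_left a).eq]
  rwa [this]

/-! ### Weights for the adjoint action of `h` -/

section Weight

variable {A : Type*} [Ring A] [Algebra ℂ A]

/-- `x` is an eigenvector of weight `w` for the adjoint action of `h`. -/
def IsWt (h : A) (w : ℂ) (x : A) : Prop := h * x = x * h + w • x

lemma IsWt.mul {h x y : A} {w w' : ℂ} (hx : IsWt h w x) (hy : IsWt h w' y) :
    IsWt h (w + w') (x * y) := by
  rw [IsWt, ← mul_assoc, hx, add_mul, mul_assoc, hy, mul_add, smul_mul_assoc, mul_smul_comm,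
    mul_assoc]
  module

lemma IsWt.one {h : A} : IsWt h 0 1 := by simp [IsWt]

lemma IsWt.pow {h x : A} {w : ℂ} (hx : IsWt h w x) (n : ℕ) : IsWt h (n * w) (x ^ n) := by
  induction n with
  | zero => simpa using IsWt.one
  | succ n ih =>
    rw [pow_succ]
    convert ih.mul hx using 1
    push_cast
    ring

lemma IsWt.list_prod {n : Type*} {h : A} {x : n → A} {w : ℂ} (hx : ∀ r, IsWt h w (x r))
    (l : List n) : IsWt h (l.length * w) (l.map x).prod := by
  induction l with
  | nil => simpa using IsWt.one
  | cons r l ih =>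
    rw [List.map_cons, List.prod_cons, List.length_cons]
    convert (hx r).mul ih using 1
    push_cast
    ring

lemma SplitRel.isWt_ordMon {E F h : A} {e f : Fin N → A} (R : SplitRel z E F h e f) (a b : ℕ)
    (l l' : List (Fin N)) :
    IsWt h ((2 * b + l'.length : ℂ) - (2 * a + l.length)) (ordMon E F e f a b l l') := by
  have hE : IsWt h 2 E := R.hE
  have hF : IsWt h (-2) F := by rw [IsWt, R.hF]; module
  have he : ∀ r, IsWt h 1 (e r) := fun r => by rw [IsWt, R.he]; module
  have hf : ∀ r, IsWt h (-1) (f r) := fun r => by rw [IsWt, R.hf]; module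
  convert (((hF.pow a).mul (IsWt.list_prod hf l)).mul (hE.pow b)).mul (IsWt.list_prod he l') using 1
  · ring
  · rfl

end Weight

lemma h_ordMon (R : SplitRel z E F h e f) (hv : h v = k • v) (a b : ℕ) (l l' : List (Fin N)) :
    h (ordMon E F e f a b l l' v) =
      (k + ((2 * b + l'.length : ℂ) - (2 * a + l.length))) • ordMon E F e f a b l l' v := by
  have := LinearMap.congr_fun (R.isWt_ordMon a b l l') v
  simp only [Module.End.mul_apply, LinearMap.add_apply, LinearMap.smul_apply, hv, map_smul] at this
  rw [this, add_smul]

lemma ordSpan_h (R : SplitRel z E F h e f) (hv : h v = k • v) :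
    ∀ x ∈ ordSpan E F e f v, h x ∈ ordSpan E F e f v := by
  refine ordSpan_stable fun a b l l' => ?_
  rw [Module.End.mul_apply, h_ordMon R hv]
  exact Submodule.smul_mem _ _ (ordMon_mem _ _ _ _)

/-- Only the powers of `F` obstruct `E`. Each crossing yields `h`, under which the span is stable
because `v` is an eigenvector, and quadratic terms in `e` and `f`, under which stability is already
known. -/
lemma ordSpan_E (R : SplitRel z E F h e f) (hv : h v = k • v) :
    ∀ x ∈ ordSpan E F e f v, E x ∈ ordSpan E F e f v := by
  refine ordSpan_stable fun a b l l' => ?_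
  induction a with
  | zero =>
    have : E * ordMon E F e f 0 b l l' = ordMon E F e f 0 (b + 1) l l' := by
      simp only [ordMon, pow_zero, one_mul, ← mul_assoc, (commute_list_prod R.Ef l).eq, pow_succ']
    rw [this]
    exact ordMon_mem _ _ _ _
  | succ a ih =>
    have h1 : ordMon E F e f (a + 1) b l l' = F * ordMon E F e f a b l l' := by
      simp only [ordMon, pow_succ', mul_assoc]
    have hm := ordMon_mem (E := E) (F := F) (e := e) (f := f) (v := v) a b l l'
    rw [h1, ← mul_assoc, R.EF]
    simp only [sub_mul, add_mul, LinearMap.sub_apply, LinearMap.add_apply, Module.End.mul_apply,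
      LinearMap.smul_apply, LinearMap.sum_apply]
    rw [Module.End.mul_apply] at ih
    refine Submodule.sub_mem _ (Submodule.add_mem _ (ordSpan_F _ ih) (ordSpan_h R hv _ hm)) ?_
    refine Submodule.smul_mem _ _ (Submodule.sum_mem _ fun r _ => Submodule.sum_mem _ fun s _ =>
      Submodule.smul_mem _ _ (Submodule.add_mem _ ?_ ?_))
    · exact ordSpan_e R r _ (ordSpan_f R s _ hm)
    · exact ordSpan_f R r _ (ordSpan_e R s _ hm)

/-- A combination of eigenvectors that is an eigenvector is a combination of the given ones with
the same eigenvalue. -/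
lemma mem_span_of_eigenvector {T : Set V} (hT : ∀ t ∈ T, ∃ μ : ℂ, h t = μ • t) {x : V}
    (hx : x ∈ Submodule.span ℂ T) (hk : h x = k • x) :
    x ∈ Submodule.span ℂ {t ∈ T | h t = k • t} := by
  -- Spanning vectors are sorted by eigenvalue; independence of the eigenspaces then removes the
  -- part with eigenvalues other than `k`.
  have h1 : Submodule.span ℂ T ≤ Submodule.span ℂ {t ∈ T | h t = k • t} ⊔
      ⨆ (μ : ℂ) (_ : μ ≠ k), h.eigenspace μ := by
    refine Submodule.span_le.2 fun t ht => ?_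
    obtain ⟨μ, hμ⟩ := hT t ht
    by_cases hμk : μ = k
    · exact Submodule.mem_sup_left (Submodule.subset_span ⟨ht, hμk ▸ hμ⟩)
    · refine Submodule.mem_sup_right (Submodule.mem_iSup_of_mem μ (Submodule.mem_iSup_of_mem hμk ?_))
      exact Module.End.mem_eigenspace_iff.2 hμ
  obtain ⟨y, hy, w, hw, rfl⟩ := Submodule.mem_sup.1 (h1 hx)
  have hy' : y ∈ h.eigenspace k := by
    have : Submodule.span ℂ {t ∈ T | h t = k • t} ≤ h.eigenspace k :=
      Submodule.span_le.2 fun t ht => Module.End.mem_eigenspace_iff.2 ht.2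
    exact this hy
  have hw' : w ∈ h.eigenspace k := by
    have := Submodule.sub_mem _ (Module.End.mem_eigenspace_iff.2 hk) hy'
    rwa [add_sub_cancel_left] at this
  have h2 := (Module.End.eigenspaces_iSupIndep h) k
  have h3 : w = 0 := Submodule.disjoint_def.1 h2 w hw' hw
  rwa [h3, add_zero]

/-- The weight space of the generating vector is spanned by the monomials of weight zero. -/
lemma mem_span_ordMon_of_weight (R : SplitRel z E F h e f) (hv : h v = k • v) {x : V}
    (hx : x ∈ ordSpan E F e f v) (hk : h x = k • x) :
    x ∈ Submodule.span ℂ {x | ∃ a b l l', 2 * a + l.length = 2 * b + l'.length ∧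
      x = ordMon E F e f a b l l' v} := by
  have h1 := mem_span_of_eigenvector (h := h) (k := k) (by
    rintro _ ⟨a, b, l, l', rfl⟩
    exact ⟨_, h_ordMon R hv a b l l'⟩) hx hk
  refine Submodule.span_le.2 ?_ h1
  rintro t ⟨⟨a, b, l, l', rfl⟩, ht⟩
  -- A monomial that kills `v` is an eigenvector for every scalar, so its degrees need not balance;
  -- it contributes nothing.
  by_cases h0 : ordMon E F e f a b l l' v = 0
  · rw [h0]
    exact Submodule.zero_mem _
  · refine Submodule.subset_span ⟨a, b, l, l', ?_, rfl⟩
    rw [h_ordMon R hv] at ht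
    have h2 := smul_left_injective ℂ h0 ht
    have h3 : ((2 * a + l.length : ℕ) : ℂ) = (2 * b + l'.length : ℕ) := by
      push_cast
      linear_combination -h2
    exact_mod_cast h3

end Span

/-! ### The induced module and the spanning property -/

section Induced

variable {N : ℕ}

/-- The enveloping algebra is generated by the Lie algebra. -/
lemma subalgebra_eq_top (S : Subalgebra ℂ (U N)) (hS : ∀ x, ι x ∈ S) : S = ⊤ := by
  let g : JacobiLie N →ₗ⁅ℂ⁆ S :=
    { toFun := fun x => ⟨ι x, hS x⟩
      map_add' := fun x y => Subtype.ext (map_add (UniversalEnvelopingAlgebra.ι ℂ) x y)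
      map_smul' := fun c x => Subtype.ext (map_smul (UniversalEnvelopingAlgebra.ι ℂ) c x)
      map_lie' := fun {x y} => Subtype.ext (LieHom.map_lie (UniversalEnvelopingAlgebra.ι ℂ) x y) }
  -- By the universal property, lifting to `S` and then including is the identity, so every element
  -- lies in `S`.
  have h1 : S.val.comp (UniversalEnvelopingAlgebra.lift ℂ g) = AlgHom.id ℂ (U N) := by
    refine UniversalEnvelopingAlgebra.hom_ext ℂ (LieHom.ext fun x => ?_)
    simp only [LieHom.comp_apply, AlgHom.coe_toLieHom, AlgHom.comp_apply,
      UniversalEnvelopingAlgebra.lift_ι_apply]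
    rfl
  refine Algebra.eq_top_iff.2 fun u => ?_
  have h2 := DFunLike.congr_fun h1 u
  rw [AlgHom.comp_apply, AlgHom.id_apply] at h2
  rw [← h2]
  exact Subtype.property _

lemma commute_et (r s : Fin N) : Commute (ι (et r)) (ι (et s)) := by
  rw [Commute, SemiconjBy, ι_lie, lie_et_et, ι_zero, add_zero]

lemma commute_ft (r s : Fin N) : Commute (ι (ft r)) (ι (ft s)) := by
  rw [Commute, SemiconjBy, ι_lie, lie_ft_ft, ι_zero, add_zero]

lemma monF_eq_ordMon (L : Matrix (Fin N) (Fin N) ℂ) (a b : ℕ) (I K : Fin N → ℕ) :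
    ∃ l l' : List (Fin N), l.length = ∑ r, I r ∧ l'.length = ∑ r, K r ∧
      monF L a b I K =
        ordMon (Enu L) (Fnu L) (fun r => ι (et r)) (fun r => ι (ft r)) a b l l' := by
  obtain ⟨l, hl, h⟩ := exists_list_of_ofFn_pow (fun r : Fin N => ι (ft r)) I
  obtain ⟨l', hl', h'⟩ := exists_list_of_ofFn_pow (fun r : Fin N => ι (et r)) K
  exact ⟨l, l', hl, hl', by rw [monF, fPow, ePow, h, h', ordMon]⟩

lemma ordMon_eq_monF (L : Matrix (Fin N) (Fin N) ℂ) (a b : ℕ) (l l' : List (Fin N)) :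
    ∃ I K : Fin N → ℕ, ∑ r, I r = l.length ∧ ∑ r, K r = l'.length ∧
      ordMon (Enu L) (Fnu L) (fun r => ι (et r)) (fun r => ι (ft r)) a b l l' =
        monF L a b I K := by
  obtain ⟨I, hI, h⟩ := exists_ofFn_pow_of_list (fun r : Fin N => ι (ft r)) commute_ft l
  obtain ⟨K, hK, h'⟩ := exists_ofFn_pow_of_list (fun r : Fin N => ι (et r)) commute_et l'
  exact ⟨I, K, hI, hK, by rw [monF, fPow, ePow, ordMon, h, h']⟩

lemma monE_eq_ordMon (L : Matrix (Fin N) (Fin N) ℂ) (a b : ℕ) (I K : Fin N → ℕ) :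
    ∃ l l' : List (Fin N), l.length = ∑ r, I r ∧ l'.length = ∑ r, K r ∧
      monE L a b I K =
        ordMon (Fnu L) (Enu L) (fun r => ι (ft r)) (fun r => ι (et r)) b a l' l := by
  obtain ⟨l, hl, h⟩ := exists_list_of_ofFn_pow (fun r : Fin N => ι (ft r)) I
  obtain ⟨l', hl', h'⟩ := exists_list_of_ofFn_pow (fun r : Fin N => ι (et r)) K
  exact ⟨l, l', hl, hl', by rw [monE, fPow, ePow, h, h', ordMon]⟩

lemma ordMon_eq_monE (L : Matrix (Fin N) (Fin N) ℂ) (a b : ℕ) (l l' : List (Fin N)) :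
    ∃ I K : Fin N → ℕ, ∑ r, I r = l.length ∧ ∑ r, K r = l'.length ∧
      ordMon (Fnu L) (Enu L) (fun r => ι (ft r)) (fun r => ι (et r)) b a l' l =
        monE L a b I K := by
  obtain ⟨I, hI, h⟩ := exists_ofFn_pow_of_list (fun r : Fin N => ι (ft r)) commute_ft l
  obtain ⟨K, hK, h'⟩ := exists_ofFn_pow_of_list (fun r : Fin N => ι (et r)) commute_et l'
  exact ⟨I, K, hI, hK, by rw [monE, fPow, ePow, ordMon, h, h']⟩

lemma map_ordMon {A B : Type*} [Ring A] [Algebra ℂ A] [Ring B] [Algebra ℂ B] (ρ : A →ₐ[ℂ] B)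
    (E F : A) (e f : Fin N → A) (a b : ℕ) (l l' : List (Fin N)) :
    ρ (ordMon E F e f a b l l') =
      ordMon (ρ E) (ρ F) (fun r => ρ (e r)) (fun r => ρ (f r)) a b l l' := by
  simp only [ordMon, map_mul, map_pow, map_list_prod, List.map_map, Function.comp_def]

/-- A subspace stable under the generators is stable under the enveloping algebra. -/
lemma stable_of_generators {V : Type*} [AddCommGroup V] [Module ℂ V] {L : Matrix (Fin N) (Fin N) ℂ}
    (ρ : U N →ₐ[ℂ] Module.End ℂ V)
    (hρ : ∀ r s, ρ (ι (Zt r s)) = algebraMap ℂ _ (zMat L r s)) (S : Submodule ℂ V)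
    (hE : ∀ x ∈ S, ρ (Enu L) x ∈ S) (hF : ∀ x ∈ S, ρ (Fnu L) x ∈ S)
    (hH : ∀ x ∈ S, ρ (ι (Ht N)) x ∈ S) (he : ∀ r, ∀ x ∈ S, ρ (ι (et r)) x ∈ S)
    (hf : ∀ r, ∀ x ∈ S, ρ (ι (ft r)) x ∈ S) (u : U N) : ∀ x ∈ S, ρ u x ∈ S := by
  let 𝒮 : Subalgebra ℂ (Module.End ℂ V) :=
    { carrier := {T | ∀ x ∈ S, T x ∈ S}
      mul_mem' := fun {a b} ha hb x hx => ha _ (hb _ hx)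
      add_mem' := fun {a b} ha hb x hx => S.add_mem (ha _ hx) (hb _ hx)
      algebraMap_mem' := fun c x hx => S.smul_mem c hx }
  have hE' : ρ (Enu L) ∈ 𝒮 := hE
  have hF' : ρ (Fnu L) ∈ 𝒮 := hF
  have hH' : ρ (ι (Ht N)) ∈ 𝒮 := hH
  have he' : ∀ r, ρ (ι (et r)) ∈ 𝒮 := he
  have hf' : ∀ r, ρ (ι (ft r)) ∈ 𝒮 := hf
  have hq : ∀ (z : Matrix (Fin N) (Fin N) ℂ) (g : Fin N → Module.End ℂ V), (∀ r, g r ∈ 𝒮) →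
      quad z g ∈ 𝒮 := fun z g hg =>
    𝒮.smul_mem (𝒮.sum_mem fun r _ => 𝒮.sum_mem fun s _ => 𝒮.smul_mem (𝒮.mul_mem (hg r) (hg s)) _) _
  have hEt : ρ (ι (Et N)) ∈ 𝒮 := by
    have := 𝒮.add_mem hE' (hq (zMat L) _ he')
    rwa [map_Enu, sub_add_cancel] at this
  have hFt : ρ (ι (Ft N)) ∈ 𝒮 := by
    have := 𝒮.add_mem hF' (hq (-zMat L) _ hf')
    rwa [map_Fnu, sub_add_cancel] at this
  have htop : 𝒮.comap ρ = ⊤ := by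
    refine subalgebra_eq_top _ fun x => ?_
    rw [Subalgebra.mem_comap, ι_eq_sum]
    simp only [map_add, map_smul, map_sum, hρ]
    refine 𝒮.add_mem (𝒮.add_mem (𝒮.add_mem (𝒮.add_mem (𝒮.add_mem (𝒮.smul_mem hH' _)
      (𝒮.smul_mem hEt _)) (𝒮.smul_mem hFt _)) (𝒮.sum_mem fun r _ => 𝒮.smul_mem (he' r) _))
      (𝒮.sum_mem fun r _ => 𝒮.smul_mem (hf' r) _))
      (𝒮.sum_mem fun r _ => 𝒮.sum_mem fun s _ => 𝒮.smul_mem (𝒮.algebraMap_mem _) _)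
  have : u ∈ 𝒮.comap ρ := by rw [htop]; trivial
  exact this

/-! ### The induced module and its relation to `𝔻` -/

variable (k : ℂ) (L : Matrix (Fin N) (Fin N) ℂ)

/-- The module induced from the one-dimensional representation of the stabilizer. -/
abbrev IndMod : Type := U N ⧸ leftIdeal k L

/-- The action of the enveloping algebra on the induced module. -/
def act : U N →ₐ[ℂ] Module.End ℂ (IndMod k L) := Algebra.lsmul ℂ ℂ (IndMod k L)

/-- The class of an element of the enveloping algebra in the induced module. -/
def cls : U N →ₗ[ℂ] IndMod k L := (leftIdeal k L).mkQ.restrictScalars ℂ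

variable {k L}

lemma act_cls (u w : U N) : act k L u (cls k L w) = cls k L (u * w) := rfl

lemma act_cls_one (u : U N) : act k L u (cls k L 1) = cls k L u := by rw [act_cls, mul_one]

lemma cls_surjective : Function.Surjective (cls k L) := Submodule.mkQ_surjective (leftIdeal k L)

lemma cls_eq_zero {u : U N} : cls k L u = 0 ↔ u ∈ leftIdeal k L :=
  Submodule.Quotient.mk_eq_zero _

lemma cls_mul_stab (u : U N) (Y : stab N) :
    cls k L (u * ι (Y : JacobiLie N)) = -(char k L Y) • cls k L u := by
  have h1 : u * (ι (Y : JacobiLie N) + algebraMap ℂ (U N) (char k L Y)) ∈ leftIdeal k L :=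
    Ideal.mul_mem_left _ _ (Ideal.subset_span ⟨Y, rfl⟩)
  rw [← cls_eq_zero, mul_add, map_add, ← Algebra.commutes, ← Algebra.smul_def, map_smul] at h1
  rw [neg_smul]
  exact eq_neg_of_add_eq_zero_left h1

/-- Being central, `Z̃_{rs}` can be moved to the right of any `u`, where the left ideal turns it
into the scalar `-π L_{rs}`. -/
lemma act_Zt (hL : L.IsSymm) (r s : Fin N) :
    act k L (ι (Zt r s)) = algebraMap ℂ _ (zMat L r s) := by
  refine LinearMap.ext fun x => ?_
  obtain ⟨u, rfl⟩ := cls_surjective x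
  have hc : ι (Zt r s) * u = u * ι (Zt r s) := by
    have htop : Subalgebra.centralizer ℂ {ι (Zt r s)} = ⊤ := by
      refine subalgebra_eq_top _ fun x => ?_
      rw [Subalgebra.mem_centralizer_iff]
      rintro _ rfl
      rw [ι_lie, Zt_central, ι_zero, add_zero]
    have hu : u ∈ Subalgebra.centralizer ℂ {ι (Zt r s)} := by rw [htop]; trivial
    exact (Subalgebra.mem_centralizer_iff ℂ).1 hu _ rfl
  rw [act_cls, hc]
  have h1 := cls_mul_stab (k := k) (L := L) u ⟨Zt r s, Zt_mem r s⟩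
  rw [char_Zt k L hL] at h1
  rw [h1, Module.algebraMap_end_apply, zMat, Matrix.smul_apply, smul_eq_mul, neg_mul]

lemma act_Ht_cls_one : act k L (ι (Ht N)) (cls k L 1) = k • cls k L 1 := by
  have h1 := cls_mul_stab (k := k) (L := L) 1 ⟨Ht N, Ht_mem N⟩
  rw [char_Ht, neg_neg, one_mul] at h1
  rw [act_cls_one, h1]

lemma act_Ht_invariant (u : invariants N) :
    act k L (ι (Ht N)) (cls k L u) = k • cls k L u := by
  have h1 := cls_mul_stab (k := k) (L := L) u ⟨Ht N, Ht_mem N⟩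
  rw [char_Ht, neg_neg] at h1
  rw [act_cls, mem_invariants.1 u.2 _ (Ht_mem N), h1]

lemma proj_surjective : Function.Surjective (proj k L) := Ideal.Quotient.mk_surjective

lemma proj_eq_iff {u u' : invariants N} :
    proj k L u = proj k L u' ↔ (u : U N) - u' ∈ leftIdeal k L := Ideal.Quotient.eq

lemma proj_eq_of_cls_eq {u u' : invariants N} (h : cls k L u = cls k L u') :
    proj k L u = proj k L u' := by
  rw [proj_eq_iff, ← cls_eq_zero, map_sub, h, sub_self]

lemma proj_mem_of_cls_mem {S : Submodule ℂ (IDO k L)} {T : Set (IndMod k L)}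
    (hT : ∀ t ∈ T, ∃ u : invariants N, cls k L u = t ∧ proj k L u ∈ S) {u : invariants N}
    (hu : cls k L u ∈ Submodule.span ℂ T) : proj k L u ∈ S := by
  have key : ∀ x ∈ Submodule.span ℂ T, ∃ u : invariants N, cls k L u = x ∧ proj k L u ∈ S := by
    intro x hx
    induction hx using Submodule.span_induction with
    | mem x hx => exact hT x hx
    | zero => exact ⟨0, by simp, by simp⟩
    | add x y _ _ hx hy =>
      obtain ⟨a, rfl, ha⟩ := hx
      obtain ⟨b, rfl, hb⟩ := hy
      exact ⟨a + b, by simp, by rw [map_add]; exact S.add_mem ha hb⟩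
    | smul c x _ hx =>
      obtain ⟨a, rfl, ha⟩ := hx
      exact ⟨c • a, by simp, by rw [map_smul]; exact S.smul_mem c ha⟩
  obtain ⟨u', h1, h2⟩ := key _ hu
  rwa [← proj_eq_of_cls_eq h1]

lemma splitRel_act (hsymm : L.IsSymm) (hinv : IsUnit L.det) :
    SplitRel (zMat L) (act k L (Enu L)) (act k L (Fnu L)) (act k L (ι (Ht N)))
      (fun r => act k L (ι (et r))) (fun r => act k L (ι (ft r))) :=
  splitRel_of_algHom hsymm hinv _ (act_Zt hsymm)

/-- The class of an invariant in the induced module has `H̃`-weight `k`, like the generator, so it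
is a combination of ordered monomials of weight zero applied to the generator. These are invariant,
so the combination lifts to `𝔻`. -/
lemma span_one_sup_Lf (hsymm : L.IsSymm) (hinv : IsUnit L.det) :
    Submodule.span ℂ {1} ⊔ Lf k L = ⊤ := by
  have R := splitRel_act (k := k) hsymm hinv
  refine Submodule.eq_top_iff'.2 fun d => ?_
  obtain ⟨u, rfl⟩ := proj_surjective d
  have h1 := stable_of_generators (act k L) (act_Zt hsymm)
    (ordSpan (act k L (Enu L)) (act k L (Fnu L)) (fun r => act k L (ι (et r)))
      (fun r => act k L (ι (ft r))) (cls k L 1)) (ordSpan_E R act_Ht_cls_one) ordSpan_F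
    (ordSpan_h R act_Ht_cls_one) (ordSpan_e R) (ordSpan_f R) u (cls k L 1) (by
      simpa [ordMon] using ordMon_mem (E := act k L (Enu L)) (F := act k L (Fnu L))
        (e := fun r => act k L (ι (et r))) (f := fun r => act k L (ι (ft r)))
        (v := cls k L 1) 0 0 [] [])
  rw [act_cls_one] at h1
  refine proj_mem_of_cls_mem ?_ (mem_span_ordMon_of_weight R act_Ht_cls_one h1 (act_Ht_invariant u))
  rintro _ ⟨a, b, l, l', hw, rfl⟩
  obtain ⟨I, K, hI, hK, h2⟩ := ordMon_eq_monF L a b l l'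
  have hw' : 2 * a + ∑ r, I r = 2 * b + ∑ r, K r := by rw [hI, hK, hw]
  refine ⟨⟨monF L a b I K, monF_mem L a b I K hw'⟩, ?_, ?_⟩
  · rw [← map_ordMon (act k L), h2, act_cls_one]
  · rcases Nat.eq_zero_or_pos (2 * a + ∑ r, I r) with h0 | h0
    · refine Submodule.mem_sup_left (Submodule.mem_span_singleton.2 ⟨1, ?_⟩)
      have h3 : (⟨monF L a b I K, monF_mem L a b I K hw'⟩ : invariants N) = 1 := by
        refine Subtype.ext ?_
        obtain rfl : a = 0 := by omega
        obtain rfl : b = 0 := by omega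
        obtain rfl : l = [] := List.eq_nil_of_length_eq_zero (by omega)
        obtain rfl : l' = [] := List.eq_nil_of_length_eq_zero (by simpa using hw.symm)
        change monF L 0 0 I K = 1
        rw [← h2]
        simp [ordMon]
      rw [h3, map_one, one_smul]
    · exact Submodule.mem_sup_right (Submodule.subset_span ⟨a, b, I, K, hw', h0, rfl⟩)

lemma span_one_sup_Le (hsymm : L.IsSymm) (hinv : IsUnit L.det) :
    Submodule.span ℂ {1} ⊔ Le k L = ⊤ := by
  have R := (splitRel_act (k := k) hsymm hinv).swap (zMat_isSymm hsymm)
  refine Submodule.eq_top_iff'.2 fun d => ?_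
  obtain ⟨u, rfl⟩ := proj_surjective d
  -- In the exchanged relations the weight element is `-H̃`, so the generator has weight `-k`.
  have hv : (-act k L (ι (Ht N))) (cls k L 1) = (-k) • cls k L 1 := by
    rw [LinearMap.neg_apply, act_Ht_cls_one, neg_smul]
  have hv' : (-act k L (ι (Ht N))) (cls k L u) = (-k) • cls k L u := by
    rw [LinearMap.neg_apply, act_Ht_invariant, neg_smul]
  have h1 := stable_of_generators (act k L) (act_Zt hsymm)
    (ordSpan (act k L (Fnu L)) (act k L (Enu L)) (fun r => act k L (ι (ft r)))
      (fun r => act k L (ι (et r))) (cls k L 1)) ordSpan_F (ordSpan_E R hv)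
    (fun x hx => by
      have := Submodule.neg_mem _ (ordSpan_h R hv x hx)
      rwa [LinearMap.neg_apply, neg_neg] at this)
    (ordSpan_f R) (ordSpan_e R) u (cls k L 1) (by
      simpa [ordMon] using ordMon_mem (E := act k L (Fnu L)) (F := act k L (Enu L))
        (e := fun r => act k L (ι (ft r))) (f := fun r => act k L (ι (et r)))
        (v := cls k L 1) 0 0 [] [])
  rw [act_cls_one] at h1
  refine proj_mem_of_cls_mem ?_ (mem_span_ordMon_of_weight R hv h1 hv')
  rintro _ ⟨b, a, l', l, hw, rfl⟩
  obtain ⟨I, K, hI, hK, h2⟩ := ordMon_eq_monE L a b l l'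
  have hw' : 2 * a + ∑ r, I r = 2 * b + ∑ r, K r := by rw [hI, hK, hw]
  refine ⟨⟨monE L a b I K, monE_mem L a b I K hw'⟩, ?_, ?_⟩
  · rw [← map_ordMon (act k L), h2, act_cls_one]
  · rcases Nat.eq_zero_or_pos (2 * a + ∑ r, I r) with h0 | h0
    · refine Submodule.mem_sup_left (Submodule.mem_span_singleton.2 ⟨1, ?_⟩)
      have h3 : (⟨monE L a b I K, monE_mem L a b I K hw'⟩ : invariants N) = 1 := by
        refine Subtype.ext ?_
        obtain rfl : a = 0 := by omega
        obtain rfl : b = 0 := by omega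
        obtain rfl : l = [] := List.eq_nil_of_length_eq_zero (by omega)
        obtain rfl : l' = [] := List.eq_nil_of_length_eq_zero (by simpa using hw)
        change monE L 0 0 I K = 1
        rw [← h2]
        simp [ordMon]
      rw [h3, map_one, one_smul]
    · exact Submodule.mem_sup_right (Submodule.subset_span ⟨a, b, I, K, hw', h0, rfl⟩)

end Induced

/-! ### Characters from extremal vectors -/

section Characters

variable {N : ℕ} {k : ℂ} {L : Matrix (Fin N) (Fin N) ℂ}

/-- A nonzero vector on which the stabilizer acts by `-π_{k,L}` and which is killed by
representatives of a complement of the scalars defines a character. -/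
lemma exists_char_of_vector {T : Set (IDO k L)}
    (hS : Submodule.span ℂ {1} ⊔ Submodule.span ℂ T = ⊤) {M : Type*} [AddCommGroup M] [Module ℂ M]
    (σ : U N →ₐ[ℂ] Module.End ℂ M) {m : M} (hm : m ≠ 0)
    (hI : ∀ Y : stab N, σ (ι (Y : JacobiLie N)) m = -(char k L Y) • m)
    (hT : ∀ d ∈ T, ∃ u : invariants N, proj k L u = d ∧ σ u m = 0) :
    ∃ χ : IDO k L →ₐ[ℂ] ℂ, ∀ d ∈ Submodule.span ℂ T, χ d = 0 := by
  have hleft : ∀ u ∈ leftIdeal k L, σ u m = 0 := by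
    intro u hu
    induction hu using Submodule.span_induction with
    | mem x hx =>
      obtain ⟨Y, rfl⟩ := hx
      rw [map_add, LinearMap.add_apply, hI, AlgHom.commutes, Module.algebraMap_end_apply, neg_smul,
        neg_add_cancel]
    | zero => simp
    | add x y _ _ hx hy => rw [map_add, LinearMap.add_apply, hx, hy, add_zero]
    | smul c x _ hx => rw [smul_eq_mul, map_mul, Module.End.mul_apply, hx, map_zero]
  have hproj : ∀ u u' : invariants N, proj k L u = proj k L u' → σ u m = σ u' m := by
    intro u u' h
    have := hleft _ (proj_eq_iff.1 h)
    rwa [map_sub, LinearMap.sub_apply, sub_eq_zero] at this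
  have hspan : ∀ d ∈ Submodule.span ℂ T, ∃ u : invariants N, proj k L u = d ∧ σ u m = 0 := by
    intro d hd
    induction hd using Submodule.span_induction with
    | mem x hx => exact hT x hx
    | zero => exact ⟨0, by simp, by simp⟩
    | add x y _ _ hx hy =>
      obtain ⟨a, rfl, ha⟩ := hx
      obtain ⟨b, rfl, hb⟩ := hy
      exact ⟨a + b, by simp, by simp [ha, hb]⟩
    | smul c x _ hx =>
      obtain ⟨a, rfl, ha⟩ := hx
      exact ⟨c • a, by simp, by simp [ha]⟩
  -- Since the left ideal kills `m`, the vector `σ u m` depends only on the class of `u`. The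
  -- decomposition `hS` thus makes `m` a common eigenvector of the invariants, and the eigenvalue is
  -- the character.
  have hex : ∀ u : invariants N, ∃ c : ℂ, σ u m = c • m := by
    intro u
    have hu : proj k L u ∈ Submodule.span ℂ {1} ⊔ Submodule.span ℂ T := by rw [hS]; trivial
    obtain ⟨x, hx, d, hd, hxd⟩ := Submodule.mem_sup.1 hu
    obtain ⟨c, rfl⟩ := Submodule.mem_span_singleton.1 hx
    obtain ⟨u', rfl, hu'⟩ := hspan d hd
    refine ⟨c, ?_⟩
    have h1 : proj k L u = proj k L (c • 1 + u') := by
      rw [← hxd, map_add, map_smul, map_one]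
    rw [hproj _ _ h1]
    simp [hu']
  choose c hc using hex
  have hinj : ∀ {a b : ℂ}, a • m = b • m → a = b := fun h => smul_left_injective ℂ hm h
  let χ₀ : invariants N →ₐ[ℂ] ℂ :=
    { toFun := c
      map_one' := hinj (by rw [← hc]; simp)
      map_mul' := fun x y => hinj (by
        rw [← hc, mul_comm, mul_smul, ← hc x, ← map_smul, ← hc y]
        simp)
      map_zero' := hinj (by rw [← hc]; simp)
      map_add' := fun x y => hinj (by
        rw [← hc, add_smul, ← hc, ← hc]
        simp)
      commutes' := fun t => hinj (by
        rw [← hc, Subalgebra.coe_algebraMap, AlgHom.commutes]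
        simp) }
  have hχ₀ : ∀ u : invariants N, σ u m = 0 → χ₀ u = 0 := fun u hu => hinj (by
    change c u • m = _
    rw [← hc, hu, zero_smul])
  refine ⟨Ideal.Quotient.liftₐ (invIdeal k L) χ₀ fun u hu => hχ₀ u (hleft _ hu), ?_⟩
  intro d hd
  obtain ⟨u, rfl, hu⟩ := hspan d hd
  exact hχ₀ u hu

/-- A character that kills a complement of the scalars is the projection along it. -/
lemma isProjectionAlong_of_char {A : Type*} [Ring A] [Algebra ℂ A] {S : Submodule ℂ A}
    (hS : Submodule.span ℂ {1} ⊔ S = ⊤) (χ : A →ₐ[ℂ] ℂ) (hχ : ∀ d ∈ S, χ d = 0) :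
    IsProjectionAlong χ S ∧ IsCodimOneTwoSidedIdeal S := by
  have hker : ∀ d, χ d = 0 → d ∈ S := by
    intro d hd
    have hu : d ∈ Submodule.span ℂ {1} ⊔ S := by rw [hS]; trivial
    obtain ⟨x, hx, s, hs, rfl⟩ := Submodule.mem_sup.1 hu
    obtain ⟨c, rfl⟩ := Submodule.mem_span_singleton.1 hx
    rw [map_add, hχ s hs, map_smul, map_one, add_zero, smul_eq_mul, mul_one] at hd
    rwa [hd, zero_smul, zero_add]
  have hSker : S = LinearMap.ker χ.toLinearMap := by
    ext d
    exact ⟨fun h => hχ d h, fun h => hker d h⟩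
  refine ⟨⟨⟨?_, codisjoint_iff.2 hS⟩, ?_⟩, ?_, ?_⟩
  · rw [Submodule.disjoint_def]
    intro x hx hx'
    obtain ⟨c, rfl⟩ := Submodule.mem_span_singleton.1 hx
    have := hχ _ hx'
    rw [map_smul, map_one, smul_eq_mul, mul_one] at this
    rw [this, zero_smul]
  · intro c s hs
    rw [map_add, hχ s hs, AlgHom.commutes, add_zero]
    rfl
  · intro a s hs
    exact ⟨hker _ (by rw [map_mul, hχ s hs, mul_zero]), hker _ (by rw [map_mul, hχ s hs, zero_mul])⟩
  · have hsurj : Function.Surjective χ.toLinearMap := fun c =>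
      ⟨algebraMap ℂ A c, by simp⟩
    rw [hSker, (LinearMap.quotKerEquivOfSurjective _ hsurj).finrank_eq, Module.finrank_self]

/-! ### The oscillator and Verma modules -/

open scoped TensorProduct

/-- The space of the oscillator representation. -/
abbrev Osc (N : ℕ) : Type := MvPolynomial (Fin N) ℂ

/-- The space of the tensor product of the oscillator representation and a Verma module. -/
abbrev OscVerma (N : ℕ) : Type := Osc N ⊗[ℂ] Polynomial ℂ

/-- An operator on the oscillator factor. -/
def onOsc (N : ℕ) : Module.End ℂ (Osc N) →ₐ[ℂ] Module.End ℂ (OscVerma N) :=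
  (Module.endTensorEndAlgHom (R := ℂ) (S := ℂ) (A := ℂ)).comp Algebra.TensorProduct.includeLeft

/-- An operator on the Verma factor. -/
def onVerma (N : ℕ) : Module.End ℂ (Polynomial ℂ) →ₐ[ℂ] Module.End ℂ (OscVerma N) :=
  (Module.endTensorEndAlgHom (R := ℂ) (S := ℂ) (A := ℂ)).comp Algebra.TensorProduct.includeRight

lemma onOsc_tmul (T : Module.End ℂ (Osc N)) (p : Osc N) (q : Polynomial ℂ) :
    onOsc N T (p ⊗ₜ q) = T p ⊗ₜ q := by
  simp [onOsc, Module.endTensorEndAlgHom_apply]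

lemma onVerma_tmul (T : Module.End ℂ (Polynomial ℂ)) (p : Osc N) (q : Polynomial ℂ) :
    onVerma N T (p ⊗ₜ q) = p ⊗ₜ T q := by
  simp [onVerma, Module.endTensorEndAlgHom_apply]

lemma commute_onVerma_onOsc (T : Module.End ℂ (Polynomial ℂ)) (T' : Module.End ℂ (Osc N)) :
    Commute (onVerma N T) (onOsc N T') := by
  refine TensorProduct.ext' fun p q => ?_
  simp only [Module.End.mul_apply, onOsc_tmul, onVerma_tmul]

/-- Multiplication by a variable. -/
def oscMul (r : Fin N) : Module.End ℂ (Osc N) := LinearMap.mulLeft ℂ (MvPolynomial.X r)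

/-- The derivation dual to the variables with respect to a matrix. -/
def oscDer (z : Matrix (Fin N) (Fin N) ℂ) (r : Fin N) : Module.End ℂ (Osc N) :=
  ∑ s, (-(2 * z r s)) • (MvPolynomial.pderiv s).toLinearMap

lemma oscDer_apply (z : Matrix (Fin N) (Fin N) ℂ) (r : Fin N) (p : Osc N) :
    oscDer z r p = ∑ s, (-(2 * z r s)) • MvPolynomial.pderiv s p := by
  simp [oscDer]

lemma oscDer_one (z : Matrix (Fin N) (Fin N) ℂ) (r : Fin N) : oscDer z r 1 = 0 := by
  simp [oscDer]

lemma weylRel_osc (z : Matrix (Fin N) (Fin N) ℂ) : WeylRel z (oscDer z) oscMul where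
  ee r s := by
    refine Commute.sum_right _ _ _ fun i _ => Commute.sum_left _ _ _ fun j _ =>
      (Commute.smul_left ?_ _).smul_right _
    refine LinearMap.ext fun p => ?_
    -- The commutator of two derivations is a derivation, so its vanishing is tested on the
    -- variables.
    have h0 : ⁅MvPolynomial.pderiv (R := ℂ) j, MvPolynomial.pderiv (R := ℂ) i⁆ = 0 :=
      MvPolynomial.derivation_ext fun q => by
        rw [Derivation.commutator_apply]
        simp [MvPolynomial.pderiv_X, Pi.single_apply, apply_ite]
    have h1 := DFunLike.congr_fun h0 p
    rw [Derivation.commutator_apply] at h1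
    exact sub_eq_zero.1 h1
  ff r s := by
    refine LinearMap.ext fun p => ?_
    simp only [oscMul, Module.End.mul_apply, LinearMap.mulLeft_apply]
    ring
  ef r s := by
    refine LinearMap.ext fun p => ?_
    have h1 : ∀ i, MvPolynomial.pderiv i (MvPolynomial.X s * p) =
        MvPolynomial.X s * MvPolynomial.pderiv i p + if i = s then p else 0 := fun i => by
      rw [Derivation.leibniz, MvPolynomial.pderiv_X, smul_eq_mul, smul_eq_mul, Pi.single_apply]
      simp [eq_comm]
    rw [LinearMap.sub_apply, Module.End.mul_apply, Module.End.mul_apply]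
    simp only [oscMul, oscDer_apply, LinearMap.mulLeft_apply, LinearMap.smul_apply,
      Module.End.one_apply, h1, smul_add, Finset.sum_add_distrib, Finset.mul_sum, mul_neg, mul_smul_comm, smul_ite, smul_zero,
      Finset.sum_ite_eq', Finset.mem_univ, if_true, neg_smul, sub_eq_add_neg]

/-- Multiplication by the variable. -/
def vermaMul : Module.End ℂ (Polynomial ℂ) := LinearMap.mulLeft ℂ Polynomial.X

/-- Differentiation. -/
def vermaDer : Module.End ℂ (Polynomial ℂ) := Polynomial.derivative

lemma vermaDer_mul : vermaDer * vermaMul = vermaMul * vermaDer + 1 := by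
  refine LinearMap.ext fun p => ?_
  simp [vermaDer, vermaMul, add_comm]

/-- The `sl₂`-relations of the Verma module with extremal weight `t`. -/
lemma verma_rel {A : Type*} [Ring A] [Algebra ℂ A] {x d : A} (hd : d * x = x * d + 1) (t : ℂ) :
    (t • d - x * d * d) * x = x * (t • d - x * d * d) + (t • 1 - (2 : ℂ) • (x * d)) ∧
    (t • 1 - (2 : ℂ) • (x * d)) * (t • d - x * d * d) =
      (t • d - x * d * d) * (t • 1 - (2 : ℂ) • (x * d)) + (2 : ℂ) • (t • d - x * d * d) ∧
    (t • 1 - (2 : ℂ) • (x * d)) * x = x * (t • 1 - (2 : ℂ) • (x * d)) - (2 : ℂ) • x := by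
  have h1 : ∀ w, d * (x * w) = x * (d * w) + w := fun w => by
    rw [← mul_assoc, hd, add_mul, one_mul, mul_assoc]
  refine ⟨?_, ?_, ?_⟩ <;>
    simp only [sub_mul, mul_sub, smul_mul_assoc, mul_smul_comm, mul_assoc, hd, h1, mul_add,
      one_mul, mul_one, smul_sub, smul_add] <;> module

/-- The oscillator-Verma module. -/
lemma decoupledRel_oscVerma (z : Matrix (Fin N) (Fin N) ℂ) (t : ℂ) :
    DecoupledRel z (onVerma N (t • vermaDer - vermaMul * vermaDer * vermaDer))
      (onVerma N vermaMul) (onVerma N (t • 1 - (2 : ℂ) • (vermaMul * vermaDer)))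
      (fun r => onOsc N (oscDer z r)) (fun r => onOsc N (oscMul r)) := by
  obtain ⟨h1, h2, h3⟩ := verma_rel vermaDer_mul t
  have W := weylRel_osc z
  exact
    { ee := fun r s => (W.ee r s).map (onOsc N)
      ff := fun r s => (W.ff r s).map (onOsc N)
      ef := fun r s => by rw [← map_mul, W.ef, map_sub, map_mul, map_smul, map_one]
      Ee := fun r => commute_onVerma_onOsc _ _
      Ef := fun r => commute_onVerma_onOsc _ _
      Fe := fun r => commute_onVerma_onOsc _ _
      Ff := fun r => commute_onVerma_onOsc _ _
      he := fun r => commute_onVerma_onOsc _ _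
      hf := fun r => commute_onVerma_onOsc _ _
      EF := by rw [← map_mul, h1, map_add, map_mul]
      hE := by rw [← map_mul, h2, map_add, map_mul, map_smul]
      hF := by rw [← map_mul, h3, map_sub, map_mul, map_smul] }

lemma DecoupledRel.swap {A : Type*} [Ring A] [Algebra ℂ A] {z : Matrix (Fin N) (Fin N) ℂ}
    {E F h : A} {e f : Fin N → A} (R : DecoupledRel z E F h e f) (hz : z.IsSymm) :
    DecoupledRel (-z) F E (-h) f e where
  toWeylRel := R.toWeylRel.swap hz
  Ee := R.Ff
  Ef := R.Fe
  Fe := R.Ef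
  Ff := R.Ee
  he r := (R.hf r).neg_left
  hf r := (R.he r).neg_left
  EF := by
    rw [R.EF]
    abel
  hE := by
    rw [neg_mul, R.hF, mul_neg]
    abel
  hF := by
    rw [neg_mul, R.hE, mul_neg]
    abel

/-- The action of the oscillator weight on a vector killed by the lowering operators. -/
lemma oscWeight_apply {V : Type*} [AddCommGroup V] [Module ℂ V] {z : Matrix (Fin N) (Fin N) ℂ}
    {e f : Fin N → Module.End ℂ V} (R : WeylRel z e f) (hz : z.IsSymm) (hu : IsUnit z.det) {m : V}
    (hm : ∀ r, e r m = 0) : oscWeight z e f m = (-(N / 2 : ℂ)) • m := by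
  have h1 : ∀ r s, (e r * f s + f r * e s) m = (-(2 * z r s)) • m := by
    intro r s
    rw [R.ef]
    simp [hm]
  -- By symmetry of `z` this is the trace of `z⁻¹ z`, the source of the shift by `N/2`.
  have h2 : ∑ r, ∑ s, z⁻¹ r s * z r s = N := by
    have h3 : ∀ r, ∑ s, z⁻¹ r s * z r s = 1 := fun r => by
      have := congrFun (congrFun (Matrix.nonsing_inv_mul z hu) r) r
      rw [Matrix.mul_apply, Matrix.one_apply_eq] at this
      rw [← this]
      exact Finset.sum_congr rfl fun s _ => by rw [hz.apply]
    simp [h3]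
  simp only [oscWeight, LinearMap.smul_apply, LinearMap.sum_apply, h1, smul_smul, ← Finset.sum_smul,
    mul_neg, mul_left_comm _ (2 : ℂ), ← Finset.mul_sum, Finset.sum_neg_distrib, h2]
  congr 1
  ring

lemma ordMon_apply_eq_zero {V : Type*} [AddCommGroup V] [Module ℂ V] {E F : Module.End ℂ V}
    {e f : Fin N → Module.End ℂ V} {m : V} (hE : E m = 0) (he : ∀ r, e r m = 0) (a b : ℕ)
    (l l' : List (Fin N)) (hpos : 0 < 2 * b + l'.length) : ordMon E F e f a b l l' m = 0 := by
  have hl : ∀ l' : List (Fin N), l' ≠ [] → (l'.map e).prod m = 0 := by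
    intro l' hl'
    induction l' with
    | nil => exact absurd rfl hl'
    | cons r l' ih =>
      rw [List.map_cons, List.prod_cons, Module.End.mul_apply]
      rcases eq_or_ne l' [] with rfl | h
      · simp [he]
      · rw [ih h, map_zero]
  rw [ordMon, Module.End.mul_apply]
  rcases eq_or_ne l' [] with rfl | h
  · obtain ⟨c, rfl⟩ : ∃ c, b = c + 1 := ⟨b - 1, by simp at hpos; omega⟩
    simp [pow_succ, hE]
  · rw [hl l' h, map_zero]

/-! ### From extremal vectors to characters -/

section Extremal

variable {V : Type*} [AddCommGroup V] [Module ℂ V] {E F h : Module.End ℂ V}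
  {e f : Fin N → Module.End ℂ V} {m : V} {t : ℂ}

lemma JacobiRel.rep_stab (R : JacobiRel (zMat L) E F h e f) (hsymm : L.IsSymm) (hm : h m = k • m)
    (Y : stab N) :
    R.rep (zMat_isSymm hsymm) (ι (Y : JacobiLie N)) m = -(char k L Y) • m := by
  rw [R.rep_ι, repLin_stab hsymm k, LinearMap.sub_apply, LinearMap.smul_apply, LinearMap.sub_apply, hm]
  simp

/-- A highest weight vector of the decoupled algebra defines a character vanishing on `Lf`. -/
lemma exists_char_Lf_of_vector (R : DecoupledRel (zMat L) E F h e f) (hsymm : L.IsSymm)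
    (hinv : IsUnit L.det) (hm : m ≠ 0) (hE : E m = 0) (he : ∀ r, e r m = 0)
    (hh : h m = (k + N / 2) • m) : ∃ χ : IDO k L →ₐ[ℂ] ℂ, ∀ d ∈ Lf k L, χ d = 0 := by
  have hz := zMat_isSymm hsymm
  have hu := zMat_isUnit hinv
  have RJ := R.jacobi hz hu
  have hk : (h + oscWeight (zMat L) e f) m = k • m := by
    rw [LinearMap.add_apply, hh, oscWeight_apply R.toWeylRel hz hu he, ← add_smul]
    congr 1
    ring
  refine exists_char_of_vector (span_one_sup_Lf hsymm hinv) (RJ.rep hz) hm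
    (RJ.rep_stab hsymm hk) ?_
  rintro _ ⟨a, b, I, K, hw, hpos, rfl⟩
  refine ⟨_, rfl, ?_⟩
  obtain ⟨l, l', hl, hl', h1⟩ := monF_eq_ordMon L a b I K
  change RJ.rep hz (monF L a b I K) _ = 0
  rw [h1, map_ordMon, map_Enu]
  simp only [RJ.rep_ι, repLin_Et, repLin_et, add_sub_cancel_right]
  exact ordMon_apply_eq_zero hE he _ _ _ _ (by omega)

/-- A lowest weight vector of the decoupled algebra defines a character vanishing on `Le`. -/
lemma exists_char_Le_of_vector (R : DecoupledRel (zMat L) E F h e f) (hsymm : L.IsSymm)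
    (hinv : IsUnit L.det) (hm : m ≠ 0) (hF : F m = 0) (hf : ∀ r, f r m = 0)
    (hh : h m = (k - N / 2) • m) : ∃ χ : IDO k L →ₐ[ℂ] ℂ, ∀ d ∈ Le k L, χ d = 0 := by
  have hz := zMat_isSymm hsymm
  have hu := zMat_isUnit hinv
  have hu' : IsUnit (-zMat L).det := by simpa [Matrix.det_neg, isUnit_iff_ne_zero] using hu
  have RJ := R.jacobi hz hu
  have hk : (h + oscWeight (zMat L) e f) m = k • m := by
    have h1 := oscWeight_apply (R.toWeylRel.swap hz) hz.neg hu' hf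
    rw [oscWeight_swap, LinearMap.neg_apply, neg_smul, neg_inj] at h1
    rw [LinearMap.add_apply, hh, h1, ← add_smul]
    congr 1
    ring
  refine exists_char_of_vector (span_one_sup_Le hsymm hinv) (RJ.rep hz) hm
    (RJ.rep_stab hsymm hk) ?_
  rintro _ ⟨a, b, I, K, hw, hpos, rfl⟩
  refine ⟨_, rfl, ?_⟩
  obtain ⟨l, l', hl, hl', h1⟩ := monE_eq_ordMon L a b I K
  change RJ.rep hz (monE L a b I K) _ = 0
  rw [h1, map_ordMon, map_Fnu]
  simp only [RJ.rep_ι, repLin_Ft, repLin_ft, add_sub_cancel_right]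
  exact ordMon_apply_eq_zero hF hf _ _ _ _ (by omega)

end Extremal

lemma one_tmul_one_ne_zero : (1 : Osc N) ⊗ₜ[ℂ] (1 : Polynomial ℂ) ≠ 0 := by
  intro h
  -- Evaluation at the origin in both factors sends the tensor to `1`.
  have h1 := congrArg (TensorProduct.lift ((LinearMap.mul ℂ ℂ).compl₁₂
    (MvPolynomial.aeval (R := ℂ) (S₁ := ℂ) (0 : Fin N → ℂ)).toLinearMap
    (Polynomial.aeval (R := ℂ) (0 : ℂ)).toLinearMap)) h
  simp at h1

/-- The Verma weight `k + N/2` compensates the oscillator vacuum weight `-N/2`, so `H̃` acts on `1 ⊗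
1` by `k = -π_{k,L}(H̃)`. -/
lemma exists_char_Lf (hsymm : L.IsSymm) (hinv : IsUnit L.det) :
    ∃ χ : IDO k L →ₐ[ℂ] ℂ, ∀ d ∈ Lf k L, χ d = 0 := by
  refine exists_char_Lf_of_vector (decoupledRel_oscVerma (zMat L) (k + N / 2)) hsymm hinv
    one_tmul_one_ne_zero ?_ (fun r => ?_) ?_
  · rw [onVerma_tmul]
    simp [vermaDer]
  · rw [onOsc_tmul, oscDer_one, TensorProduct.zero_tmul]
  · rw [onVerma_tmul]
    simp [vermaDer]

/-- The same module is built for `-z` and then exchanged, which restores `z` and makes `1 ⊗ 1` a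
lowest weight vector. Its `h`-weight `k - N/2` is corrected by the oscillator weight `N/2`. -/
lemma exists_char_Le (hsymm : L.IsSymm) (hinv : IsUnit L.det) :
    ∃ χ : IDO k L →ₐ[ℂ] ℂ, ∀ d ∈ Le k L, χ d = 0 := by
  have R := (decoupledRel_oscVerma (-zMat L) (-(k - N / 2))).swap (zMat_isSymm hsymm).neg
  rw [neg_neg] at R
  refine exists_char_Le_of_vector R hsymm hinv one_tmul_one_ne_zero ?_ (fun r => ?_) ?_
  · rw [onVerma_tmul]
    simp [vermaDer]
  · rw [onOsc_tmul, oscDer_one, TensorProduct.zero_tmul]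
  · rw [LinearMap.neg_apply, onVerma_tmul]
    simp only [LinearMap.sub_apply, LinearMap.smul_apply, Module.End.mul_apply, Module.End.one_apply,
      vermaDer, Polynomial.derivative_one, map_zero, smul_zero, sub_zero, TensorProduct.tmul_smul]
    module

end Characters

/-! ### Classification of the characters -/

section Classification

variable {N : ℕ} {k : ℂ} {L : Matrix (Fin N) (Fin N) ℂ}

/-- The elements `ẽ_r` and `f̃_r` are not in `𝔻`, so a character of `𝔻` is moved to a linear
functional on the endomorphisms of the induced module, where the decoupled relations hold exactly.
-/
lemma exists_functional_comp_eq {X Y : Type*} [AddCommGroup X] [Module ℂ X] [AddCommGroup Y]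
    [Module ℂ Y] (g : X →ₗ[ℂ] Y) (ψ : X →ₗ[ℂ] ℂ) (hker : LinearMap.ker g ≤ LinearMap.ker ψ) :
    ∃ Φ : Y →ₗ[ℂ] ℂ, ∀ x, Φ (g x) = ψ x := by
  obtain ⟨Φ, hΦ⟩ := LinearMap.exists_extend
    (((LinearMap.ker g).liftQ ψ hker).comp g.quotKerEquivRange.symm.toLinearMap)
  refine ⟨Φ, fun x => ?_⟩
  have h1 := LinearMap.congr_fun hΦ ⟨g x, LinearMap.mem_range_self g x⟩
  rw [LinearMap.comp_apply, Submodule.subtype_apply] at h1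
  rw [h1, LinearMap.comp_apply]
  have h2 : g.quotKerEquivRange.symm.toLinearMap ⟨g x, LinearMap.mem_range_self g x⟩ =
      (LinearMap.ker g).mkQ x := by
    rw [LinearEquiv.coe_coe, LinearEquiv.symm_apply_eq]
    rfl
  rw [h2, Submodule.mkQ_apply, Submodule.liftQ_apply]

/-- The elements of weight `w` in the enveloping algebra. -/
def weightSpace (N : ℕ) (w : ℤ) : Submodule ℂ (U N) where
  carrier := {u | HasWeight w u}
  add_mem' h h' := h.add h'
  zero_mem' := HasWeight.zero
  smul_mem' c _ h := h.smul c

/-- The operators on the induced module of weight `w`. -/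
def actWeight (k : ℂ) (L : Matrix (Fin N) (Fin N) ℂ) (w : ℤ) :
    Submodule ℂ (Module.End ℂ (IndMod k L)) :=
  (weightSpace N w).map (act k L).toLinearMap

lemma act_mem_actWeight {w : ℤ} {u : U N} (hu : HasWeight w u) : act k L u ∈ actWeight k L w :=
  ⟨u, hu, rfl⟩

lemma isHomog_act : IsHomog (actWeight k L) (act k L (Enu L)) (act k L (Fnu L))
    (fun r => act k L (ι (et r))) (fun r => act k L (ι (ft r))) where
  e r := act_mem_actWeight (hasWeight_et r)
  f r := act_mem_actWeight (hasWeight_ft r)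
  E := act_mem_actWeight (hasWeight_Enu L)
  F := act_mem_actWeight (hasWeight_Fnu L)

/-- A character of the algebra of invariant operators, as a functional on the operators on the
induced module. -/
lemma exists_gradedChar (χ : IDO k L →ₐ[ℂ] ℂ) :
    ∃ Φ : Module.End ℂ (IndMod k L) →ₗ[ℂ] ℂ, GradedChar (actWeight k L) Φ ∧
      ∀ u : invariants N, Φ (act k L u) = χ (proj k L u) := by
  obtain ⟨Φ, hΦ⟩ := exists_functional_comp_eq
    ((act k L).toLinearMap.comp (invariants N).val.toLinearMap)
    (χ.toLinearMap.comp (proj k L).toLinearMap) (by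
      -- An invariant acting by zero sends the class of `1` to zero, so it lies in the left ideal
      -- and vanishes in `𝔻`.
      intro u hu
      have h1 : act k L u = 0 := hu
      have h2 : cls k L u = cls k L (0 : invariants N) := by
        rw [← act_cls_one, h1, LinearMap.zero_apply, ZeroMemClass.coe_zero, map_zero]
      change χ (proj k L u) = 0
      rw [proj_eq_of_cls_eq h2, map_zero, map_zero])
  have hΦ' : ∀ u : invariants N, Φ (act k L u) = χ (proj k L u) := hΦ
  refine ⟨Φ, ⟨⟨1, HasWeight.one, map_one (act k L)⟩, ?_, ?_, ?_⟩, hΦ'⟩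
  · rintro i j _ _ ⟨u, hu, rfl⟩ ⟨w, hw, rfl⟩
    exact ⟨u * w, HasWeight.mul hu hw, map_mul (act k L) _ _⟩
  · have := hΦ' 1
    rwa [OneMemClass.coe_one, map_one (act k L), map_one (proj k L), map_one χ] at this
  · rintro _ _ ⟨u, hu, rfl⟩ ⟨w, hw, rfl⟩
    have h1 := hΦ' ⟨u, HasWeight.mem_invariants hu⟩
    have h2 := hΦ' ⟨w, HasWeight.mem_invariants hw⟩
    have h3 := hΦ' (⟨u, HasWeight.mem_invariants hu⟩ * ⟨w, HasWeight.mem_invariants hw⟩)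
    rw [map_mul, map_mul, ← h1, ← h2, MulMemClass.mk_mul_mk, map_mul] at h3
    exact h3

lemma exists_zMat_ne_zero (hN : 1 < N) (hinv : IsUnit L.det) : ∃ r p, zMat L r p ≠ 0 := by
  obtain ⟨s, r, q, p, hm⟩ := exists_minor_ne_zero hN (zMat_isUnit hinv)
  by_contra! h0
  exact hm (by simp [h0])

/-- Every character vanishes on `Lf` or on `Le`. -/
lemma char_vanishes (hN : 1 < N) (hsymm : L.IsSymm) (hinv : IsUnit L.det) (χ : IDO k L →ₐ[ℂ] ℂ) :
    (∀ d ∈ Lf k L, χ d = 0) ∨ ∀ d ∈ Le k L, χ d = 0 := by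
  obtain ⟨Φ, C, hΦ⟩ := exists_gradedChar χ
  have R := splitRel_act (k := k) hsymm hinv
  have hz := zMat_isSymm hsymm
  obtain ⟨r, p, hrp⟩ := exists_zMat_ne_zero hN hinv
  refine (map_fe_dichotomy R C isHomog_act hN hz (zMat_isUnit hinv)).imp (fun h0 => ?_) fun h0 => ?_
  · suffices Lf k L ≤ LinearMap.ker χ.toLinearMap from fun d hd => this hd
    refine Submodule.span_le.2 ?_
    rintro _ ⟨a, b, I, K, hw, hpos, rfl⟩
    obtain ⟨l, l', hl, hl', h1⟩ := monF_eq_ordMon L a b I K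
    change χ (proj k L _) = 0
    rw [← hΦ]
    change Φ (act k L (monF L a b I K)) = 0
    rw [h1, map_ordMon]
    exact map_monomial_eq_zero R C isHomog_act h0 hrp a b l l' (by omega) (by omega)
  · suffices Le k L ≤ LinearMap.ker χ.toLinearMap from fun d hd => this hd
    refine Submodule.span_le.2 ?_
    rintro _ ⟨a, b, I, K, hw, hpos, rfl⟩
    obtain ⟨l, l', hl, hl', h1⟩ := monE_eq_ordMon L a b I K
    change χ (proj k L _) = 0
    rw [← hΦ]
    change Φ (act k L (monE L a b I K)) = 0
    rw [h1, map_ordMon]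
    -- The exchange negates `z` and the grading; `monE` becomes an ordered monomial with the two
    -- degrees and the two words interchanged.
    exact map_monomial_eq_zero (R.swap hz) C.swap isHomog_act.swap h0
      (by rwa [Matrix.neg_apply, neg_ne_zero]) b a l' l (by omega) (by omega)

/-- No character vanishes on both `Lf` and `Le`. -/
lemma not_vanishes_both (hN : 1 < N) (hsymm : L.IsSymm) (hinv : IsUnit L.det)
    (χ : IDO k L →ₐ[ℂ] ℂ) (hf : ∀ d ∈ Lf k L, χ d = 0) (he : ∀ d ∈ Le k L, χ d = 0) : False := by
  obtain ⟨Φ, C, hΦ⟩ := exists_gradedChar χ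
  have R := splitRel_act (k := k) hsymm hinv
  obtain ⟨r, s, hrs⟩ := exists_zMat_ne_zero hN hinv
  have h1 : Φ (act k L (ι (ft s)) * act k L (ι (et r))) = 0 := by
    obtain ⟨I, K, hI, hK, h⟩ := ordMon_eq_monF L 0 0 [s] [r]
    simp only [List.length_singleton] at hI hK
    have hw : 2 * 0 + ∑ r, I r = 2 * 0 + ∑ r, K r := by rw [hI, hK]
    have h2 := hf _ (Submodule.subset_span ⟨0, 0, I, K, hw, by omega, rfl⟩)
    rw [← hΦ] at h2
    change Φ (act k L (monF L 0 0 I K)) = 0 at h2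
    rw [← h] at h2
    simpa [ordMon] using h2
  have h2 : Φ (act k L (ι (et r)) * act k L (ι (ft s))) = 0 := by
    obtain ⟨I, K, hI, hK, h⟩ := ordMon_eq_monE L 0 0 [s] [r]
    simp only [List.length_singleton] at hI hK
    have hw : 2 * 0 + ∑ r, I r = 2 * 0 + ∑ r, K r := by rw [hI, hK]
    have h2 := he _ (Submodule.subset_span ⟨0, 0, I, K, hw, by omega, rfl⟩)
    rw [← hΦ] at h2
    change Φ (act k L (monE L 0 0 I K)) = 0 at h2
    rw [← h] at h2
    simpa [ordMon] using h2
  -- The two vanishing values differ by `2 z_{rs}`, which is nonzero.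
  rw [R.ef, map_sub, h1, map_smul, C.map_one, zero_sub, neg_eq_zero, smul_eq_mul, mul_one] at h2
  exact mul_ne_zero two_ne_zero hrs h2

lemma algHom_eq_of_vanishes {A : Type*} [Ring A] [Algebra ℂ A] {S : Submodule ℂ A}
    (hS : Submodule.span ℂ {1} ⊔ S = ⊤) (χ χ' : A →ₐ[ℂ] ℂ) (hχ : ∀ d ∈ S, χ d = 0)
    (hχ' : ∀ d ∈ S, χ' d = 0) : χ = χ' := by
  refine AlgHom.ext fun d => ?_
  have hu : d ∈ Submodule.span ℂ {1} ⊔ S := by rw [hS]; trivial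
  obtain ⟨x, hx, s, hs, rfl⟩ := Submodule.mem_sup.1 hu
  obtain ⟨c, rfl⟩ := Submodule.mem_span_singleton.1 hx
  simp [hχ s hs, hχ' s hs]

end Classification

end JacobiIDO

end

theorem theorem5p4 (N : ℕ) (hN : 1 < N) (k : ℂ) (L : Matrix (Fin N) (Fin N) ℂ)
    (hsymm : L.IsSymm) (hinv : IsUnit L.det) :
    JacobiIDO.IsCodimOneTwoSidedIdeal (JacobiIDO.Lf k L) ∧
    JacobiIDO.IsCodimOneTwoSidedIdeal (JacobiIDO.Le k L) ∧
    ∃ χf χe : JacobiIDO.IDO k L →ₐ[ℂ] ℂ,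
      JacobiIDO.IsProjectionAlong χf (JacobiIDO.Lf k L) ∧
      JacobiIDO.IsProjectionAlong χe (JacobiIDO.Le k L) ∧
      χf ≠ χe ∧
      ∀ χ : JacobiIDO.IDO k L →ₐ[ℂ] ℂ, χ = χf ∨ χ = χe := by
  obtain ⟨χf, hf⟩ := JacobiIDO.exists_char_Lf (k := k) hsymm hinv
  obtain ⟨χe, he⟩ := JacobiIDO.exists_char_Le (k := k) hsymm hinv
  have hSf := JacobiIDO.span_one_sup_Lf (k := k) hsymm hinv
  have hSe := JacobiIDO.span_one_sup_Le (k := k) hsymm hinv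
  obtain ⟨pf, cf⟩ := JacobiIDO.isProjectionAlong_of_char hSf χf hf
  obtain ⟨pe, ce⟩ := JacobiIDO.isProjectionAlong_of_char hSe χe he
  refine ⟨cf, ce, χf, χe, pf, pe, ?_, fun χ => ?_⟩
  · rintro rfl
    exact JacobiIDO.not_vanishes_both hN hsymm hinv χf hf he
  · exact (JacobiIDO.char_vanishes hN hsymm hinv χ).imp
      (fun h => JacobiIDO.algHom_eq_of_vanishes hSf χ χf h hf)
      (fun h => JacobiIDO.algHom_eq_of_vanishes hSe χ χe h he)
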